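/- Let $T = S^1\times S^1$ be the closed torus with its product orientation, let $\hat\pi$ be the set of free homotopy classes of loops on $T$, and let $\mathbb{Q}\hat\pi$ be the $\mathbb{Q}$-vector space with basis $\hat\pi$. For $i,j\in\mathbb{Z}$ let $a^ib^j\in\hat\pi$ denote the class of the loop $t\mapsto(e^{2\pi\sqrt{-1}\,it},e^{2\pi\sqrt{-1}\,jt})$, so that $a$ and $b$ are the classes of the two factor circles and $1=a^0b^0$ is the class of contractible loops. The Goldman bracket is the bilinear map $[-,-]:\mathbb{Q}\hat\pi\times\mathbb{Q}\hat\pi\to\mathbb{Q}\hat\pi$ such that, for any two smooth loops $\alpha,\beta$ on $T$ all of whose intersections are transverse, $$[\alpha,\beta]=\sum_{p\in\alpha\cap\beta}\epsilon(p)\,\alpha *_p\beta ,$$ where intersections are counted as pairs of parameters $(s,t)$ with $\alpha(s)=\beta(t)=p$, the sign $\epsilon(p)$ is $1$ if the velocities of $\alpha$ and $\beta$ at $p$, in this order, match the orientation of $T$ and $-1$ otherwise, and $\alpha *_p\beta$ is the class of the loop that runs once around $\alpha$ starting at $p$ and then once around $\beta$. There is exactly one such bilinear map; it satisfies $[a^ib^j,a^kb^l]=(il-jk)\,a^{i+k}b^{j+l}$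 for all $i,j,k,l\in\mathbb{Z}$, and it is a Lie bracket. The resulting Lie algebra over $\mathbb{Q}$, the Goldman Lie algebra of the closed torus, is finitely generated. Specifically, it is generated by the five classes $1$, $a$, $b$, $a^{-1}$, $b^{-1}$; and the Lie subalgebra generated by the four classes $a$, $b$, $a^{-1}$, $b^{-1}$ is exactly the span of all classes of non-contractible loops. -/

import Mathlib

open scoped Manifold ContDiff

noncomputable section

/-! ### Free homotopy classes of loops in a topological space -/

/-- Loops in `X`: continuous maps from the circle `ℝ / ℤ` to `X`. -/
abbrev FreeLoop (X : Type*) [TopologicalSpace X] := C(UnitAddCircle, X)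

/-- Free homotopy of loops (no base point is kept fixed). -/
def freeHomotopySetoid (X : Type*) [TopologicalSpace X] : Setoid (FreeLoop X) where
  r := ContinuousMap.Homotopic
  iseqv := ContinuousMap.Homotopic.equivalence

/-- The set of free homotopy classes of loops in `X`. -/
def FreeLoopClass (X : Type*) [TopologicalSpace X] : Type _ := Quotient (freeHomotopySetoid X)

namespace FreeLoop

variable {X : Type*} [TopologicalSpace X]

/-- The free homotopy class of a loop. -/
def toClass (γ : FreeLoop X) : FreeLoopClass X := Quotient.mk (freeHomotopySetoid X) γ

/-- The loop `γ` traversed once, starting and ending at `γ s`, as a path. -/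
def pathFrom (γ : FreeLoop X) (s : UnitAddCircle) : Path (γ s) (γ s) where
  toFun r := γ (s + ((r : ℝ) : UnitAddCircle))
  continuous_toFun := by
    have h : Continuous fun r : unitInterval => s + ((r : ℝ) : UnitAddCircle) :=
      continuous_const.add ((AddCircle.continuous_mk' (1 : ℝ)).comp continuous_subtype_val)
    exact γ.continuous.comp h
  source' := by simp
  target' := by
    have h : (((1 : unitInterval) : ℝ) : UnitAddCircle) = 0 := AddCircle.coe_period (1 : ℝ)
    simp only [h, add_zero]

/-- A closed path, regarded as a map from the circle. -/
def ofPath {x : X} (p : Path x x) : FreeLoop X where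
  toFun := AddCircle.liftIco 1 0 (fun r : ℝ => p.extend r)
  continuous_toFun := AddCircle.liftIco_continuous (by simp) p.continuous_extend.continuousOn

/-- The concatenation of `α` and `β` at the common point `α s = β t`: first go once around `α`
starting from its parameter `s`, then once around `β` starting from its parameter `t`. -/
def concatAt (α β : FreeLoop X) (s t : UnitAddCircle) (h : α s = β t) : FreeLoop X :=
  ofPath ((α.pathFrom s).trans ((β.pathFrom t).cast h h))

end FreeLoop

/-! ### Smooth loops on the closed torus, and the Goldman bracket -/

/-- The closed torus `S¹ × S¹`. -/
abbrev Torus := Circle × Circle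

namespace Torus

/-- A loop on the torus is smooth if it is a smooth `1`-periodic map from the line. -/
def IsSmoothLoop (γ : FreeLoop Torus) : Prop :=
  ContMDiff 𝓘(ℝ, ℝ) ((𝓡 1).prod (𝓡 1)) ∞ (fun r : ℝ => γ (r : UnitAddCircle))

/-- The velocity of a smooth loop `γ = (z, w)` at `s`, in the frame `(i z, 0)`, `(0, i w)` of the
tangent plane of `S¹ × S¹ ⊆ ℂ × ℂ` at `(z, w)`, so that its coordinates are
`z' / (i z) = Im (z' / z)` and `w' / (i w) = Im (w' / w)`. This frame, in this order, fixes the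
orientation of the torus. -/
def velocity (γ : FreeLoop Torus) (s : UnitAddCircle) : ℝ × ℝ :=
  ((deriv (fun r : ℝ => ((γ (s + (r : UnitAddCircle))).1 : ℂ)) 0 / ((γ s).1 : ℂ)).im,
   (deriv (fun r : ℝ => ((γ (s + (r : UnitAddCircle))).2 : ℂ)) 0 / ((γ s).2 : ℂ)).im)

/-- The determinant of the velocities of `α` at `s` and `β` at `t`. -/
def velocityDet (α β : FreeLoop Torus) (s t : UnitAddCircle) : ℝ :=
  (velocity α s).1 * (velocity β t).2 - (velocity α s).2 * (velocity β t).1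

/-- The intersections of `α` and `β`, recorded by their parameters. At a double point `p` exactly
one pair `(s, t)` satisfies `α s = p = β t`. -/
def Intersection (α β : FreeLoop Torus) : Type :=
  {q : UnitAddCircle × UnitAddCircle // α q.1 = β q.2}

/-- `α` and `β` are smooth loops all of whose intersections are transverse. (By compactness, the
intersections are then finite in number.) -/
structure TransversePair (α β : FreeLoop Torus) : Prop where
  smooth_left : IsSmoothLoop α
  smooth_right : IsSmoothLoop β
  transverse : ∀ s t, α s = β t → velocityDet α β s t ≠ 0

/-- The sign of an intersection: `1` if the velocities of `α` and `β`, in this order, match the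
orientation of the torus, and `-1` if they do not. -/
def Intersection.sgn {α β : FreeLoop Torus} (p : Intersection α β) : ℚ :=
  ((SignType.sign (velocityDet α β p.1.1 p.1.2) : ℤ) : ℚ)

/-- The free homotopy class of the loop `α *_p β`. -/
def Intersection.concatClass {α β : FreeLoop Torus} (p : Intersection α β) : FreeLoopClass Torus :=
  (FreeLoop.concatAt α β p.1.1 p.1.2 p.2).toClass

/-- The `ℚ`-vector space with basis the free homotopy classes of loops on the torus. -/
abbrev GoldmanSpace := FreeLoopClass Torus →₀ ℚ

/-- A free homotopy class as a basis vector. -/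
def basisVec (c : FreeLoopClass Torus) : GoldmanSpace := Finsupp.single c 1

/-- `B` is the Goldman bracket: it is bilinear and `[α, β] = ∑ p, ε(p) α *_p β`, the sum over the
intersections of `α` and `β`, for all transverse smooth representatives `α`, `β`. -/
def IsGoldmanBracket (B : GoldmanSpace →ₗ[ℚ] GoldmanSpace →ₗ[ℚ] GoldmanSpace) : Prop :=
  ∀ α β : FreeLoop Torus, TransversePair α β →
    B (basisVec α.toClass) (basisVec β.toClass) =
      ∑ᶠ p : Intersection α β, p.sgn • basisVec p.concatClass

/-- The class `a ^ i b ^ j`, where `a` is the loop `t ↦ (e ^ (2 π i t), 1)` and `b` is the loop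
`t ↦ (1, e ^ (2 π i t))`. -/
def word (i j : ℤ) : FreeLoopClass Torus :=
  FreeLoop.toClass
    { toFun := fun t => (AddCircle.toCircle t ^ i, AddCircle.toCircle t ^ j)
      continuous_toFun :=
        (AddCircle.continuous_toCircle.zpow i).prodMk (AddCircle.continuous_toCircle.zpow j) }

end Torus

/-! ### Lie algebras given by a bilinear bracket -/

/-- The bilinear map `B` is a Lie bracket: it is alternating and satisfies the Jacobi identity. -/
structure IsLieBracket {V : Type*} [AddCommGroup V] [Module ℚ V] (B : V →ₗ[ℚ] V →ₗ[ℚ] V) :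
    Prop where
  self : ∀ x, B x x = 0
  jacobi : ∀ x y z, B x (B y z) + B y (B z x) + B z (B x y) = 0

namespace IsLieBracket

variable {V : Type*} [AddCommGroup V] [Module ℚ V] {B : V →ₗ[ℚ] V →ₗ[ℚ] V}

theorem skew (h : IsLieBracket B) (x y : V) : B x y = -B y x := by
  have h1 := h.self (x + y)
  simp only [map_add, LinearMap.add_apply, h.self, zero_add, add_zero] at h1
  exact eq_neg_of_add_eq_zero_right h1

/-- `V` with the Lie bracket `B`. -/
abbrev lieRing (h : IsLieBracket B) : LieRing V where
  bracket x y := B x y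
  add_lie x y z := by change B (x + y) z = B x z + B y z; simp
  lie_add x y z := by change B x (y + z) = B x y + B x z; simp
  lie_self x := h.self x
  leibniz_lie x y z := by
    change B x (B y z) = B (B x y) z + B y (B x z)
    have h1 := h.jacobi x y z
    rw [h.skew z x, map_neg, h.skew z (B x y)] at h1
    rw [← sub_eq_zero, ← h1]
    abel

/-- `V` with the Lie bracket `B`, as a Lie algebra over `ℚ`. -/
abbrev lieAlgebra (h : IsLieBracket B) : letI := h.lieRing; LieAlgebra ℚ V :=
  letI := h.lieRing
  { (inferInstance : Module ℚ V) with
    lie_smul := fun t x y => (B x).map_smul t y }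

/-- The Lie subalgebra of `V`, with bracket `B`, generated by the set `S`. -/
def generate (h : IsLieBracket B) (S : Set V) : Submodule ℚ V :=
  letI := h.lieRing
  letI := h.lieAlgebra
  (LieSubalgebra.lieSpan ℚ V S).toSubmodule

end IsLieBracket

end

/-!
A loop on the torus lifts to a curve `A = (x, y)` in the plane with `A (t + 1) = A t + (i, j)`, and
the bidegree `(i, j)` determines its free homotopy class, because the difference of `A` and the
linear curve `t ↦ (i t, j t)` is periodic and can be scaled to zero. Bidegrees add under
concatenation at any common point. So the Goldman sum of two transverse loops `α`, `β` of bidegrees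
`(i, j)` and `(k, l)` is a multiple of `a ^ (i + k) b ^ (j + l)`, and the point is that the signs of
the intersections add up to `i l - j k` (`Torus.TransversePair.sum_sgn`).

The intersections are the zeros modulo `ℤ²` of `(s, t) ↦ A s - B t`, where `A` and `B` are lifts of
`α` and `β`. For a continuous function `φ` on `ℝ² / ℤ²`, consider the integral of
`φ (A s - B t) det (A' s, B' t)` over a period square. It equals `i l - j k` times the integral of
`φ` (`ClosedCurveLift.pullbackIntegral_eq`): if `φ` is a character, the integral separates into
integrals over `s` and `t` that the fundamental theorem of calculus controls, and linear
combinations of characters are dense. If `φ` is a tent function concentrated near `0`, the integral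
is supported near the intersections, and a change of variables around each of them turns it into the
number of intersections, counted with signs, times the integral of `φ`
(`ClosedCurveLift.Transverse.sum_sign`).

Conversely, any two classes have transverse representatives, namely linear loops, translated off
each other if they are parallel (`Torus.exists_transversePair`). Hence the bracket is unique. The
formula for it on the basis gives the Jacobi identity. Bracketing with `a`, `b` and their inverses
moves between neighbouring points of the lattice of classes and reaches every nonzero one
(`Torus.nontrivialSpan_le`), whereas no bracket has a component along the class of contractible
loops (`Torus.bracket_mem_nontrivialSpan`).
-/

/-! ### The degree of a map from the circle to itself -/

/-- The universal covering `x ↦ exp (2 π i x)` of the circle by the line. -/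
noncomputable def unitExp (x : ℝ) : Circle := AddCircle.toCircle (x : UnitAddCircle)

theorem continuous_unitExp : Continuous unitExp :=
  AddCircle.continuous_toCircle.comp (AddCircle.continuous_mk' 1)

theorem unitExp_add (x y : ℝ) : unitExp (x + y) = unitExp x * unitExp y := by
  rw [unitExp, AddCircle.coe_add, AddCircle.toCircle_add]
  rfl

theorem unitExp_neg (x : ℝ) : unitExp (-x) = (unitExp x)⁻¹ := by
  rw [unitExp, AddCircle.coe_neg, AddCircle.toCircle_neg]
  rfl

@[simp] theorem unitExp_zero : unitExp 0 = 1 := by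
  simp [unitExp]

theorem unitExp_eq_exp (x : ℝ) : unitExp x = Circle.exp (2 * Real.pi * x) := by
  rw [unitExp, AddCircle.toCircle_apply_mk, div_one]

theorem unitExp_int_mul (n : ℤ) (x : ℝ) :
    unitExp (n * x) = AddCircle.toCircle (x : UnitAddCircle) ^ n := by
  rw [← AddCircle.toCircle_zsmul, ← AddCircle.coe_zsmul, zsmul_eq_mul, unitExp]

theorem unitExp_eq_iff {x y : ℝ} : unitExp x = unitExp y ↔ ∃ m : ℤ, x = y + m := by
  rw [unitExp, unitExp, (AddCircle.injective_toCircle one_ne_zero).eq_iff, ← sub_eq_zero,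
    ← AddCircle.coe_sub, AddCircle.coe_eq_zero_iff]
  simp only [zsmul_eq_mul, mul_one]
  constructor
  · rintro ⟨m, h⟩
    exact ⟨m, by linarith⟩
  · rintro ⟨m, h⟩
    exact ⟨m, by linarith⟩

/-- `γ` has degree `n` if it is the `n`-th power map times the exponential of a continuous real
function on the circle. -/
def HasDegree (γ : C(UnitAddCircle, Circle)) (n : ℤ) : Prop :=
  ∃ u : C(UnitAddCircle, ℝ), ∀ x, γ x = x.toCircle ^ n * unitExp (u x)

/-- A continuous integer-valued function on the line is constant. -/
theorem eq_of_continuous_of_forall_int {f : ℝ → ℝ} (hf : Continuous f)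
    (h : ∀ x, ∃ m : ℤ, f x = m) (x y : ℝ) : f x = f y := by
  choose m hm using h
  have hm' : Continuous m := by
    rw [Int.isClosedEmbedding_coe_real.isEmbedding.continuous_iff]
    exact hf.congr hm
  rw [hm, hm, PreconnectedSpace.constant inferInstance hm']

theorem continuous_coe_unitAddCircle : Continuous fun x : ℝ => (x : UnitAddCircle) :=
  AddCircle.continuous_mk' 1

theorem exists_mem_Ico_coe_eq (a : ℝ) (x : UnitAddCircle) :
    ∃ r ∈ Set.Ico a (a + 1), (r : UnitAddCircle) = x :=
  ⟨_, (AddCircle.equivIco (1 : ℝ) a x).2, (AddCircle.equivIco (1 : ℝ) a).symm_apply_apply x⟩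

namespace HasDegree

variable {γ γ' : C(UnitAddCircle, Circle)} {m n : ℤ}

/-- The degree is the increment over one period of any lift of the map to the line. -/
theorem lift_add_one (h : HasDegree γ n) {A : ℝ → ℝ} (hA : Continuous A)
    (hγ : ∀ x : ℝ, γ (x : UnitAddCircle) = unitExp (A x)) (x : ℝ) : A (x + 1) = A x + n := by
  obtain ⟨u, hu⟩ := h
  have hc : Continuous fun x : ℝ => A x - n * x - u (x : UnitAddCircle) := by
    have := continuous_coe_unitAddCircle
    fun_prop
  have := eq_of_continuous_of_forall_int hc (fun x => by
    have := (hu x).symm.trans (hγ x)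
    rw [← unitExp_int_mul, ← unitExp_add, eq_comm, unitExp_eq_iff] at this
    obtain ⟨k, hk⟩ := this
    exact ⟨k, by linarith⟩) (x + 1) x
  have h1 : ((x + 1 : ℝ) : UnitAddCircle) = x := AddCircle.coe_add_period 1 x
  rw [h1] at this
  linarith

theorem exists_lift (h : HasDegree γ n) :
    ∃ A : ℝ → ℝ, Continuous A ∧ ∀ x : ℝ, γ (x : UnitAddCircle) = unitExp (A x) := by
  obtain ⟨u, hu⟩ := h
  refine ⟨fun x => n * x + u (x : UnitAddCircle), ?_, fun x => ?_⟩
  · have := continuous_coe_unitAddCircle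
    fun_prop
  · rw [hu, unitExp_add, unitExp_int_mul]

theorem unique (h : HasDegree γ m) (h' : HasDegree γ n) : m = n := by
  obtain ⟨A, hA, hγ⟩ := h.exists_lift
  have h1 := h.lift_add_one hA hγ 0
  have h2 := h'.lift_add_one hA hγ 0
  exact_mod_cast add_left_cancel (h1.symm.trans h2)

/-- A lift over one period with increment `n` shows that the degree is `n`. -/
theorem of_lift {A : ℝ → ℝ} (hA : ContinuousOn A (Set.Icc 0 1))
    (hγ : ∀ x ∈ Set.Icc (0 : ℝ) 1, γ (x : UnitAddCircle) = unitExp (A x))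
    (hn : A 1 = A 0 + n) : HasDegree γ n := by
  refine ⟨⟨AddCircle.liftIco 1 0 fun r => A r - n * r, AddCircle.liftIco_continuous ?_ ?_⟩,
    fun x => ?_⟩
  · simp [hn]
  · rw [zero_add]
    fun_prop
  · obtain ⟨s, hs, rfl⟩ := exists_mem_Ico_coe_eq 0 x
    change γ s = _ * unitExp (AddCircle.liftIco 1 0 (fun r => A r - n * r) s)
    rw [AddCircle.liftIco_coe_apply hs, ← unitExp_int_mul,
      ← unitExp_add, hγ s ⟨hs.1, by linarith [hs.2]⟩]
    congr 1
    ring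

/-- Every map from the circle to itself has a degree, because paths lift along `ℝ → ℝ / ℤ`. -/
theorem exists_degree (γ : C(UnitAddCircle, Circle)) : ∃ n, HasDegree γ n := by
  let e := AddCircle.homeomorphCircle (T := (1 : ℝ)) one_ne_zero
  let p : C(unitInterval, UnitAddCircle) :=
    ⟨fun r => e.symm (γ ((r : ℝ) : UnitAddCircle)), e.symm.continuous.comp
      (γ.continuous.comp (continuous_coe_unitAddCircle.comp continuous_subtype_val))⟩
  obtain ⟨a, ha⟩ := QuotientAddGroup.mk_surjective (p 0)
  obtain ⟨Γ, hΓ, -⟩ := (AddCircle.isCoveringMap_coe (1 : ℝ)).exists_path_lifts p a ha.symm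
  have hΓ' : ∀ r : unitInterval, γ ((r : ℝ) : UnitAddCircle) = unitExp (Γ r) := by
    intro r
    have h1 : (Γ r : UnitAddCircle) = e.symm (γ ((r : ℝ) : UnitAddCircle)) := congrFun hΓ r
    rw [unitExp, h1, ← AddCircle.homeomorphCircle_apply one_ne_zero]
    exact (e.apply_symm_apply _).symm
  have h01 : unitExp (Γ 1) = unitExp (Γ 0) := by
    rw [← hΓ', ← hΓ']
    congr 1
    simp
  obtain ⟨n, hn⟩ := unitExp_eq_iff.1 h01
  refine ⟨n, of_lift (A := Set.IccExtend zero_le_one Γ)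
    (Γ.continuous.Icc_extend' (h := zero_le_one)).continuousOn (fun x hx => ?_) ?_⟩
  · rw [Set.IccExtend_of_mem _ _ hx]
    exact hΓ' ⟨x, hx⟩
  · rw [Set.IccExtend_right, Set.IccExtend_left]
    exact hn

/-- Nearby maps have the same degree: their quotient takes values in the right half plane, so that
it has a continuous logarithm. -/
theorem of_dist_lt (h : HasDegree γ n) (hd : ∀ x, dist (γ' x) (γ x) < 1) : HasDegree γ' n := by
  have hs : ∀ x, ((γ' x * (γ x)⁻¹ : Circle) : ℂ) ∈ Complex.slitPlane := by
    intro x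
    have h1 : ‖((γ' x * (γ x)⁻¹ : Circle) : ℂ) - 1‖ < 1 := by
      have h2 : ((γ' x * (γ x)⁻¹ : Circle) : ℂ) - 1 = (γ' x - γ x) * ((γ x)⁻¹ : Circle) := by
        rw [Circle.coe_mul, sub_mul, ← Circle.coe_mul (γ x), mul_inv_cancel, Circle.coe_one]
      rw [h2, norm_mul, Circle.norm_coe, mul_one, ← dist_eq_norm]
      exact hd x
    refine Or.inl ?_
    have h3 := (abs_lt.1 ((Complex.abs_re_le_norm _).trans_lt h1)).1
    simp only [Complex.sub_re, Complex.one_re] at h3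
    linarith
  obtain ⟨u, hu⟩ := h
  let v : UnitAddCircle → ℝ := fun x => Complex.arg (γ' x * (γ x)⁻¹ : Circle) / (2 * Real.pi)
  have hv : Continuous v := by
    refine Continuous.div_const (continuous_iff_continuousAt.2 fun x => ?_) _
    exact (Complex.continuousAt_arg (hs x)).comp (f := fun x => ((γ' x * (γ x)⁻¹ : Circle) : ℂ))
      (by fun_prop)
  refine ⟨u + ⟨v, hv⟩, fun x => ?_⟩
  have h4 : unitExp (v x) = γ' x * (γ x)⁻¹ := by
    rw [unitExp_eq_exp, mul_div_cancel₀ _ (by positivity), Circle.exp_arg]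
  change γ' x = _ * unitExp (u x + v x)
  rw [unitExp_add, ← mul_assoc, ← hu, h4, mul_comm, inv_mul_cancel_right]

theorem homotopic (h : HasDegree γ n) (hγ : γ.Homotopic γ') : HasDegree γ' n := by
  obtain ⟨H⟩ := hγ
  choose d hd using exists_degree
  have hloc : IsLocallyConstant d := by
    rw [IsLocallyConstant.iff_exists_open]
    refine fun α => ⟨Metric.ball α 1, Metric.isOpen_ball, Metric.mem_ball_self one_pos,
      fun β hβ => (hd β).unique ((hd α).of_dist_lt fun x => ?_)⟩
    exact (ContinuousMap.dist_apply_le_dist x).trans_lt hβ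
  have h01 := PreconnectedSpace.constant inferInstance
    (hloc.continuous.comp H.curry.continuous) (x := 0) (y := 1)
  have h0 : H.curry 0 = γ := by ext; simp
  have h1 : H.curry 1 = γ' := by ext; simp
  simp only [Function.comp_apply, h0, h1] at h01
  rw [(h.unique (hd γ)).trans h01]
  exact hd γ'

/-- A map of degree `n` is homotopic to the `n`-th power map: the logarithm of the quotient can be
scaled to zero. -/
theorem exists_homotopy (h : HasDegree γ n) :
    ∃ H : C(unitInterval × UnitAddCircle, Circle),
      (∀ x, H (0, x) = γ x) ∧ ∀ x, H (1, x) = x.toCircle ^ n := by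
  obtain ⟨u, hu⟩ := h
  refine ⟨⟨fun p => p.2.toCircle ^ n * unitExp ((1 - p.1) * u p.2), ?_⟩, fun x => ?_, fun x => ?_⟩
  · refine Continuous.mul ?_ (continuous_unitExp.comp (by fun_prop))
    exact (AddCircle.continuous_toCircle.comp continuous_snd).zpow n
  · simp [hu]
  · simp

end HasDegree

/-! ### Free homotopy classes on the torus are classified by their bidegree -/

namespace Torus

/-- The two coordinates of the loop `γ` on the torus have degrees `i` and `j`. -/
structure HasBidegree (γ : FreeLoop Torus) (i j : ℤ) : Prop where
  fst : HasDegree (ContinuousMap.fst.comp γ) i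
  snd : HasDegree (ContinuousMap.snd.comp γ) j

theorem HasBidegree.toClass_eq {γ : FreeLoop Torus} {i j : ℤ} (h : HasBidegree γ i j) :
    γ.toClass = word i j := by
  obtain ⟨H, H0, H1⟩ := h.fst.exists_homotopy
  obtain ⟨K, K0, K1⟩ := h.snd.exists_homotopy
  refine Quotient.sound (s := freeHomotopySetoid Torus) ⟨⟨H.prodMk K, fun x => ?_, fun x => ?_⟩⟩
  · exact Prod.ext (H0 x) (K0 x)
  · exact Prod.ext (H1 x) (K1 x)

theorem exists_hasBidegree (γ : FreeLoop Torus) : ∃ i j, HasBidegree γ i j := by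
  obtain ⟨i, hi⟩ := HasDegree.exists_degree (ContinuousMap.fst.comp γ)
  obtain ⟨j, hj⟩ := HasDegree.exists_degree (ContinuousMap.snd.comp γ)
  exact ⟨i, j, hi, hj⟩

theorem exists_word_eq (c : FreeLoopClass Torus) : ∃ i j, word i j = c := by
  induction c using Quotient.inductionOn with
  | h γ =>
    obtain ⟨i, j, h⟩ := exists_hasBidegree γ
    exact ⟨i, j, h.toClass_eq.symm⟩

theorem HasBidegree.of_homotopic {γ γ' : FreeLoop Torus} {i j : ℤ} (h : HasBidegree γ i j)
    (hγ : γ.Homotopic γ') : HasBidegree γ' i j :=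
  ⟨h.fst.homotopic ((ContinuousMap.Homotopic.refl _).comp hγ),
    h.snd.homotopic ((ContinuousMap.Homotopic.refl _).comp hγ)⟩

theorem hasBidegree_of_toClass_eq {γ : FreeLoop Torus} {i j : ℤ} (h : γ.toClass = word i j) :
    HasBidegree γ i j := by
  have h' := Quotient.exact (s := freeHomotopySetoid Torus) h.symm
  refine HasBidegree.of_homotopic ⟨⟨0, fun x => ?_⟩, ⟨0, fun x => ?_⟩⟩ h' <;>
  simp

theorem word_injective {i j k l : ℤ} (h : word i j = word k l) : i = k ∧ j = l := by
  have h1 := hasBidegree_of_toClass_eq (i := i) (j := j) rfl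
  have h2 := hasBidegree_of_toClass_eq h
  exact ⟨h1.fst.unique h2.fst, h1.snd.unique h2.snd⟩

end Torus

/-- A loop in the circle that runs through `γ` from the parameter `s` and then through `δ` from the
parameter `t` has the sum of their degrees. -/
theorem HasDegree.concat {γ δ η : C(UnitAddCircle, Circle)} {m n : ℤ} (hγ : HasDegree γ m)
    (hδ : HasDegree δ n) (s t : ℝ)
    (h₁ : ∀ r ∈ Set.Icc (0 : ℝ) (1 / 2), η r = γ ((s + 2 * r : ℝ) : UnitAddCircle))
    (h₂ : ∀ r ∈ Set.Icc (1 / 2 : ℝ) 1, η r = δ ((t + (2 * r - 1) : ℝ) : UnitAddCircle)) :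
    HasDegree η (m + n) := by
  obtain ⟨A, hA, hAγ⟩ := hγ.exists_lift
  obtain ⟨B, hB, hBδ⟩ := hδ.exists_lift
  have hA1 := hγ.lift_add_one hA hAγ s
  have hB1 := hδ.lift_add_one hB hBδ t
  -- The lifts of the two halves agree at the middle up to an integer `k`.
  obtain ⟨k, hk⟩ : ∃ k : ℤ, A (s + 1) = B t + k := by
    rw [← unitExp_eq_iff, ← hAγ, ← hBδ]
    have e1 := h₁ (1 / 2) (by norm_num)
    have e2 := h₂ (1 / 2) (by norm_num)
    norm_num at e1 e2
    simpa using e1.symm.trans e2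
  refine of_lift (A := fun r => if r ≤ 1 / 2 then A (s + 2 * r) else B (t + (2 * r - 1)) + k)
    (Continuous.if_le (by fun_prop) (by fun_prop) continuous_id continuous_const ?_).continuousOn
    (fun r hr => ?_) ?_
  · rintro r rfl
    norm_num
    exact hk
  · split_ifs with h
    · rw [h₁ r ⟨hr.1, h⟩, hAγ]
    · rw [h₂ r ⟨(not_le.1 h).le, hr.2⟩, hBδ, unitExp_eq_iff]
      exact ⟨-k, by push_cast; ring⟩
  · norm_num
    linarith

namespace Torus

variable {α β : FreeLoop Torus}

theorem concatAt_apply_of_le {s t : ℝ} (h : α s = β t) {r : ℝ} (hr : r ∈ Set.Icc (0 : ℝ) (1 / 2)) :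
    FreeLoop.concatAt α β s t h r = α ((s + 2 * r : ℝ) : UnitAddCircle) := by
  have h1 : r ∈ Set.Ico (0 : ℝ) (0 + 1) := ⟨hr.1, by linarith [hr.2]⟩
  have h2 : r ∈ Set.Icc (0 : ℝ) 1 := ⟨hr.1, by linarith [hr.2]⟩
  change AddCircle.liftIco 1 0 (fun r : ℝ =>
      ((FreeLoop.pathFrom α s).trans ((FreeLoop.pathFrom β t).cast h h)).extend r) _ = _
  rw [AddCircle.liftIco_coe_apply h1, Path.extend_apply _ h2, Path.trans_apply, dif_pos hr.2]
  rfl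

theorem concatAt_apply_of_ge {s t : ℝ} (h : α s = β t) {r : ℝ} (hr : r ∈ Set.Icc (1 / 2 : ℝ) 1) :
    FreeLoop.concatAt α β s t h r = β ((t + (2 * r - 1) : ℝ) : UnitAddCircle) := by
  have hβ : ∀ r : ℝ, r ∈ Set.Icc (1 / 2 : ℝ) 1 → r ≠ 1 / 2 → r ≠ 1 →
      FreeLoop.concatAt α β s t h r = β ((t + (2 * r - 1) : ℝ) : UnitAddCircle) := by
    intro r hr hr1 hr2
    have h1 : r ∈ Set.Ico (0 : ℝ) (0 + 1) :=
      ⟨by linarith [hr.1], by linarith [lt_of_le_of_ne hr.2 hr2]⟩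
    have h2 : r ∈ Set.Icc (0 : ℝ) 1 := ⟨by linarith [hr.1], hr.2⟩
    change AddCircle.liftIco 1 0 (fun r : ℝ =>
      ((FreeLoop.pathFrom α s).trans ((FreeLoop.pathFrom β t).cast h h)).extend r) _ = _
    rw [AddCircle.liftIco_coe_apply h1, Path.extend_apply _ h2, Path.trans_apply,
      dif_neg (by change ¬ (r ≤ 1 / 2); exact not_le.2 (lt_of_le_of_ne hr.1 hr1.symm))]
    rfl
  by_cases hr1 : r = 1 / 2
  · rw [concatAt_apply_of_le h (by rw [hr1]; norm_num), hr1]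
    norm_num
    have : ((s + 1 : ℝ) : UnitAddCircle) = s := AddCircle.coe_add_period 1 s
    simpa using h
  by_cases hr2 : r = 1
  · have e1 : ((r : ℝ) : UnitAddCircle) = ((0 : ℝ) : UnitAddCircle) := by
      rw [hr2]; simp
    rw [e1, concatAt_apply_of_le h (by norm_num), hr2]
    norm_num
    simpa using h
  exact hβ r hr hr1 hr2

theorem HasBidegree.concatAt {i j k l : ℤ} (hα : HasBidegree α i j) (hβ : HasBidegree β k l)
    (s t : UnitAddCircle) (h : α s = β t) :
    HasBidegree (FreeLoop.concatAt α β s t h) (i + k) (j + l) := by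
  obtain ⟨s, rfl⟩ := QuotientAddGroup.mk_surjective s
  obtain ⟨t, rfl⟩ := QuotientAddGroup.mk_surjective t
  exact ⟨hα.fst.concat hβ.fst s t (fun r hr => congrArg Prod.fst (concatAt_apply_of_le h hr))
    (fun r hr => congrArg Prod.fst (concatAt_apply_of_ge h hr)),
    hα.snd.concat hβ.snd s t (fun r hr => congrArg Prod.snd (concatAt_apply_of_le h hr))
    (fun r hr => congrArg Prod.snd (concatAt_apply_of_ge h hr))⟩

theorem concatClass_eq {i j k l : ℤ} (hα : HasBidegree α i j) (hβ : HasBidegree β k l)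
    (p : Intersection α β) : p.concatClass = word (i + k) (j + l) :=
  (hα.concatAt hβ _ _ _).toClass_eq

end Torus

/-! ### The degree of the difference of two closed curves on the torus, as an integral -/

/-- The lift to the plane of a `C¹` closed curve on the torus `ℝ² / ℤ²` of bidegree `(i, j)`,
together with its derivative `(dx, dy)`. -/
structure ClosedCurveLift (i j : ℤ) where
  /-- The first coordinate. -/
  x : ℝ → ℝ
  /-- The second coordinate. -/
  y : ℝ → ℝ
  /-- The derivative of the first coordinate. -/
  dx : ℝ → ℝ
  /-- The derivative of the second coordinate. -/
  dy : ℝ → ℝ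
  hasDerivAt_x : ∀ t, HasDerivAt x (dx t) t
  hasDerivAt_y : ∀ t, HasDerivAt y (dy t) t
  continuous_dx : Continuous dx
  continuous_dy : Continuous dy
  x_add_one : ∀ t, x (t + 1) = x t + i
  y_add_one : ∀ t, y (t + 1) = y t + j

/-- The projection of the plane onto the torus `ℝ² / ℤ²`. -/
def planeToTorus (p : ℝ × ℝ) : UnitAddTorus (Fin 2) :=
  ![(p.1 : UnitAddCircle), (p.2 : UnitAddCircle)]

theorem continuous_planeToTorus : Continuous planeToTorus := by
  refine continuous_pi fun i => ?_
  fin_cases i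
  · exact continuous_coe_unitAddCircle.comp continuous_fst
  · exact continuous_coe_unitAddCircle.comp continuous_snd

theorem mFourier_planeToTorus (n : Fin 2 → ℤ) (p : ℝ × ℝ) :
    UnitAddTorus.mFourier n (planeToTorus p) =
      Complex.exp (2 * Real.pi * Complex.I * (n 0 * p.1 + n 1 * p.2)) := by
  change ∏ i, fourier (n i) (planeToTorus p i) = _
  rw [Fin.prod_univ_two]
  simp only [planeToTorus, Matrix.cons_val_zero, Matrix.cons_val_one, fourier_coe_apply]
  rw [← Complex.exp_add]
  congr 1
  push_cast
  ring

section

open MeasureTheory Set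

/-- The fundamental theorem of calculus over one period. -/
theorem integral_Icc_add_one_eq_sub {f f' : ℝ → ℂ} (h : ∀ t, HasDerivAt f (f' t) t)
    (hf' : Continuous f') (a : ℝ) : ∫ t in Icc a (a + 1), f' t = f (a + 1) - f a := by
  rw [integral_Icc_eq_integral_Ioc, ← intervalIntegral.integral_of_le (by linarith)]
  exact intervalIntegral.integral_eq_sub_of_hasDerivAt (fun t _ => h t)
    (hf'.intervalIntegrable _ _)

namespace ClosedCurveLift

variable {i j k l : ℤ} (A : ClosedCurveLift i j) (B : ClosedCurveLift k l)

theorem continuous_x : Continuous A.x :=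
  continuous_iff_continuousAt.2 fun t => (A.hasDerivAt_x t).continuousAt

theorem continuous_y : Continuous A.y :=
  continuous_iff_continuousAt.2 fun t => (A.hasDerivAt_y t).continuousAt

/-- The character of `ℝ² / ℤ²` with exponents `n`, along the curve. -/
noncomputable def char (n : Fin 2 → ℤ) (t : ℝ) : ℂ :=
  Complex.exp (2 * Real.pi * Complex.I * (n 0 * A.x t + n 1 * A.y t))

theorem continuous_char (n : Fin 2 → ℤ) : Continuous (A.char n) := by
  have := A.continuous_x
  have := A.continuous_y
  unfold char
  fun_prop

/-- The integral of `dx`, weighted by a character, over one period of the curve. -/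
noncomputable def charIntegralX (n : Fin 2 → ℤ) (a : ℝ) : ℂ :=
  ∫ t in Icc a (a + 1), A.char n t * A.dx t

/-- The integral of `dy`, weighted by a character, over one period of the curve. -/
noncomputable def charIntegralY (n : Fin 2 → ℤ) (a : ℝ) : ℂ :=
  ∫ t in Icc a (a + 1), A.char n t * A.dy t

theorem charIntegralX_zero (a : ℝ) : A.charIntegralX 0 a = i := by
  rw [charIntegralX]
  simp only [char, Pi.zero_apply, Int.cast_zero, zero_mul, add_zero, mul_zero, Complex.exp_zero,
    one_mul]
  rw [integral_Icc_add_one_eq_sub (fun t => (A.hasDerivAt_x t).ofReal_comp)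
    (Complex.continuous_ofReal.comp A.continuous_dx), A.x_add_one]
  push_cast
  ring

theorem charIntegralY_zero (a : ℝ) : A.charIntegralY 0 a = j := by
  rw [charIntegralY]
  simp only [char, Pi.zero_apply, Int.cast_zero, zero_mul, add_zero, mul_zero, Complex.exp_zero,
    one_mul]
  rw [integral_Icc_add_one_eq_sub (fun t => (A.hasDerivAt_y t).ofReal_comp)
    (Complex.continuous_ofReal.comp A.continuous_dy), A.y_add_one]
  push_cast
  ring

/-- The form `n 0 dx + n 1 dy`, weighted by the character of exponents `n`, is exact. -/
theorem charIntegral_exact (n : Fin 2 → ℤ) (a : ℝ) :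
    n 0 * A.charIntegralX n a + n 1 * A.charIntegralY n a = 0 := by
  have hint : ∀ f : ℝ → ℝ, Continuous f →
      IntegrableOn (fun t => A.char n t * f t) (Icc a (a + 1)) := fun f hf =>
    ((A.continuous_char n).mul (Complex.continuous_ofReal.comp hf)).integrableOn_Icc
  rw [charIntegralX, charIntegralY, ← integral_const_mul, ← integral_const_mul,
    ← integral_add ((hint _ A.continuous_dx).const_mul _) ((hint _ A.continuous_dy).const_mul _)]
  have hd : ∀ t, HasDerivAt (fun t => A.char n t / (2 * Real.pi * Complex.I))
      (n 0 * (A.char n t * A.dx t) + n 1 * (A.char n t * A.dy t)) t := by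
    intro t
    have h1 := ((((A.hasDerivAt_x t).ofReal_comp.const_mul (n 0 : ℂ)).add
      ((A.hasDerivAt_y t).ofReal_comp.const_mul (n 1 : ℂ))).const_mul
        (2 * Real.pi * Complex.I)).cexp.div_const (2 * Real.pi * Complex.I)
    refine h1.congr_deriv ?_
    have := Complex.two_pi_I_ne_zero
    simp only [char, Pi.add_apply]
    field_simp
  rw [integral_Icc_add_one_eq_sub hd]
  · have : A.char n (a + 1) = A.char n a := by
      rw [char, char, A.x_add_one, A.y_add_one, Complex.exp_eq_exp_iff_exists_int]
      exact ⟨n 0 * i + n 1 * j, by push_cast; ring⟩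
    rw [this, sub_self]
  · have := A.continuous_char n
    have := A.continuous_dx
    have := A.continuous_dy
    fun_prop

/-- The difference of two curves, as a map from the plane to itself. -/
def diff (q : ℝ × ℝ) : ℝ × ℝ := (A.x q.1 - B.x q.2, A.y q.1 - B.y q.2)

/-- The determinant of the velocities of two curves. -/
def det (q : ℝ × ℝ) : ℝ := A.dx q.1 * B.dy q.2 - A.dy q.1 * B.dx q.2

theorem continuous_diff : Continuous (A.diff B) := by
  have := A.continuous_x
  have := A.continuous_y
  have := B.continuous_x
  have := B.continuous_y
  unfold diff
  fun_prop

theorem continuous_det : Continuous (A.det B) := by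
  have := A.continuous_dx
  have := A.continuous_dy
  have := B.continuous_dx
  have := B.continuous_dy
  unfold det
  fun_prop

/-- A period square of a pair of closed curves, with lower left corner `c`. -/
def periodSquare (c : ℝ × ℝ) : Set (ℝ × ℝ) := Icc c.1 (c.1 + 1) ×ˢ Icc c.2 (c.2 + 1)

theorem isCompact_periodSquare (c : ℝ × ℝ) : IsCompact (periodSquare c) :=
  isCompact_Icc.prod isCompact_Icc

/-- The integral over a period square of the pullback of `φ dx ∧ dy` under the difference of the
two curves, up to sign. -/
noncomputable def pullbackIntegral (c : ℝ × ℝ) (φ : C(UnitAddTorus (Fin 2), ℂ)) : ℂ :=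
  ∫ q in periodSquare c, φ (planeToTorus (A.diff B q)) * A.det B q

/-- For a character, the integral separates into integrals along the two curves. If the character
is not trivial, the vectors formed by these integrals are both orthogonal to its exponents, so that
their determinant vanishes. -/
theorem pullbackIntegral_mFourier (c : ℝ × ℝ) (n : Fin 2 → ℤ) :
    A.pullbackIntegral B c (UnitAddTorus.mFourier n) =
      if n = 0 then ((i * l - j * k : ℤ) : ℂ) else 0 := by
  have h1 : A.pullbackIntegral B c (UnitAddTorus.mFourier n) =
      A.charIntegralX n c.1 * B.charIntegralY (-n) c.2 -
        A.charIntegralY n c.1 * B.charIntegralX (-n) c.2 := by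
    have hA := A.continuous_char n
    have hB := B.continuous_char (-n)
    have := A.continuous_dx
    have := A.continuous_dy
    have := B.continuous_dx
    have := B.continuous_dy
    have hK := isCompact_periodSquare c
    simp only [charIntegralX, charIntegralY]
    rw [← setIntegral_prod_mul, ← setIntegral_prod_mul, ← integral_sub]
    · rw [pullbackIntegral]
      congr 1
      funext q
      rw [mFourier_planeToTorus]
      have : Complex.exp (2 * Real.pi * Complex.I * (n 0 * (A.diff B q).1 + n 1 * (A.diff B q).2)) =
          A.char n q.1 * B.char (-n) q.2 := by
        rw [char, char, ← Complex.exp_add, diff]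
        congr 1
        simp only [Pi.neg_apply]
        push_cast
        ring
      rw [this, det]
      push_cast
      ring
    · exact ContinuousOn.integrableOn_compact hK (by fun_prop)
    · exact ContinuousOn.integrableOn_compact hK (by fun_prop)
  rw [h1]
  split_ifs with hn
  · subst hn
    rw [neg_zero, charIntegralX_zero, charIntegralX_zero, charIntegralY_zero, charIntegralY_zero]
    push_cast
    ring
  · have e1 := A.charIntegral_exact n c.1
    have e2 := B.charIntegral_exact (-n) c.2
    simp only [Pi.neg_apply, Int.cast_neg] at e2
    by_cases h0 : n 0 = 0
    · have h0' : (n 1 : ℂ) ≠ 0 := by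
        intro h
        apply hn
        ext a
        fin_cases a
        · exact h0
        · exact_mod_cast h
      refine (mul_eq_zero.1 (?_ : (n 1 : ℂ) * _ = 0)).resolve_left h0'
      linear_combination -A.charIntegralX n c.1 * e2 - B.charIntegralX (-n) c.2 * e1
    · refine (mul_eq_zero.1 (?_ : (n 0 : ℂ) * _ = 0)).resolve_left (by exact_mod_cast h0)
      linear_combination B.charIntegralY (-n) c.2 * e1 + A.charIntegralY n c.1 * e2

/-- `pullbackIntegral` as a continuous linear form. -/
noncomputable def pullbackIntegralCLM (c : ℝ × ℝ) : C(UnitAddTorus (Fin 2), ℂ) →L[ℂ] ℂ :=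
  LinearMap.mkContinuous
    { toFun := A.pullbackIntegral B c
      map_add' := fun φ ψ => by
        simp only [pullbackIntegral, ContinuousMap.add_apply, add_mul]
        have := A.continuous_diff B
        have := A.continuous_det B
        have := continuous_planeToTorus
        have hK := isCompact_periodSquare c
        refine integral_add ?_ ?_ <;>
        exact ContinuousOn.integrableOn_compact hK (by fun_prop)
      map_smul' := fun a φ => by
        simp only [pullbackIntegral, ContinuousMap.smul_apply, smul_eq_mul, mul_assoc,
          RingHom.id_apply]
        exact integral_const_mul _ _ }
    (∫ q in periodSquare c, ‖A.det B q‖) fun φ => by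
      change ‖A.pullbackIntegral B c φ‖ ≤ _
      rw [pullbackIntegral, ← integral_mul_const]
      refine norm_integral_le_of_norm_le ?_ (ae_of_all _ fun q => ?_)
      · have := A.continuous_det B
        exact ContinuousOn.integrableOn_compact (isCompact_periodSquare c) (by fun_prop)
      · rw [norm_mul, mul_comm, Complex.norm_real]
        exact mul_le_mul_of_nonneg_left (φ.norm_coe_le_norm _) (norm_nonneg _)

/-- The curve `t ↦ (t, 0)`. -/
def unitX : ClosedCurveLift 1 0 where
  x t := t
  y _ := 0
  dx _ := 1
  dy _ := 0
  hasDerivAt_x t := hasDerivAt_id t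
  hasDerivAt_y t := hasDerivAt_const t 0
  continuous_dx := continuous_const
  continuous_dy := continuous_const
  x_add_one t := by simp
  y_add_one t := by simp

/-- The curve `t ↦ (0, -t)`. -/
def negUnitY : ClosedCurveLift 0 (-1) where
  x _ := 0
  y t := -t
  dx _ := 0
  dy _ := -1
  hasDerivAt_x t := hasDerivAt_const t 0
  hasDerivAt_y t := (hasDerivAt_id t).neg
  continuous_dx := continuous_const
  continuous_dy := continuous_const
  x_add_one t := by simp
  y_add_one t := by simp; ring

/-- The degree formula: up to sign, pulling `φ dx ∧ dy` back under the difference of the curves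
multiplies its integral by the determinant of the bidegrees. Both sides are continuous in `φ`, and
trigonometric polynomials are dense. The integral of `φ` over the square `c'` is obtained as another
instance of the pullback, for two curves whose difference is the identity. -/
theorem pullbackIntegral_eq (c c' : ℝ × ℝ) (φ : C(UnitAddTorus (Fin 2), ℂ)) :
    A.pullbackIntegral B c φ =
      ((i * l - j * k : ℤ) : ℂ) * ∫ q in periodSquare c', φ (planeToTorus q) := by
  have h1 : A.pullbackIntegralCLM B c =
      (-((i * l - j * k : ℤ) : ℂ)) • unitX.pullbackIntegralCLM negUnitY c' := by
    refine ContinuousLinearMap.ext_on (s := range UnitAddTorus.mFourier) ?_ ?_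
    · exact Submodule.dense_iff_topologicalClosure_eq_top.2
        UnitAddTorus.span_mFourier_closure_eq_top
    · rintro _ ⟨n, rfl⟩
      change A.pullbackIntegral B c _ = _ * unitX.pullbackIntegral negUnitY c' _
      rw [pullbackIntegral_mFourier, pullbackIntegral_mFourier]
      split_ifs <;> simp
  have h2 := congrArg (fun L => L φ) h1
  change A.pullbackIntegral B c _ = _ * unitX.pullbackIntegral negUnitY c' _ at h2
  have h3 : ∀ q, unitX.diff negUnitY q = q := fun q => by simp [diff, unitX, negUnitY]
  have h4 : ∀ q, unitX.det negUnitY q = -1 := fun q => by simp [det, unitX, negUnitY]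
  rw [h2]
  simp only [pullbackIntegral, h3, h4]
  rw [integral_mul_const]
  push_cast
  ring

end ClosedCurveLift

/-! ### Bump functions on the torus -/

theorem planeToTorus_add (p q : ℝ × ℝ) :
    planeToTorus (p + q) = planeToTorus p + planeToTorus q := by
  ext i
  fin_cases i <;> simp [planeToTorus]

theorem norm_planeToTorus {p : ℝ × ℝ} (hp : ‖p‖ ≤ 1 / 2) : ‖planeToTorus p‖ = ‖p‖ := by
  have h := norm_prod_le_iff.1 hp
  have h1 : ‖(p.1 : UnitAddCircle)‖ = ‖p.1‖ :=
    (AddCircle.norm_coe_eq_abs_iff (1 : ℝ) one_ne_zero).2 (by simpa using h.1)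
  have h2 : ‖(p.2 : UnitAddCircle)‖ = ‖p.2‖ :=
    (AddCircle.norm_coe_eq_abs_iff (1 : ℝ) one_ne_zero).2 (by simpa using h.2)
  refine le_antisymm ((pi_norm_le_iff_of_nonneg (norm_nonneg _)).2 fun i => ?_)
    (norm_prod_le_iff.2 ⟨?_, ?_⟩)
  · fin_cases i
    · exact h1.trans_le (norm_fst_le p)
    · exact h2.trans_le (norm_snd_le p)
  · exact h1.symm.trans_le (norm_le_pi_norm (planeToTorus p) 0)
  · exact h2.symm.trans_le (norm_le_pi_norm (planeToTorus p) 1)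

theorem norm_planeToTorus_of_dist_le {p q : ℝ × ℝ} (hp : planeToTorus p = 0)
    (hq : dist q p ≤ 1 / 2) : ‖planeToTorus q‖ = dist q p := by
  have h : planeToTorus q = planeToTorus (q - p) := by
    conv_lhs => rw [← sub_add_cancel q p, planeToTorus_add, hp, add_zero]
  rw [h, dist_eq_norm, norm_planeToTorus (by rwa [← dist_eq_norm])]

/-- The tent function of radius `δ` around `0` on the torus. -/
noncomputable def tent (δ : ℝ) : C(UnitAddTorus (Fin 2), ℂ) where
  toFun z := ((max 0 (δ - ‖z‖) : ℝ) : ℂ)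
  continuous_toFun := by fun_prop

theorem tent_of_le {δ : ℝ} {z : UnitAddTorus (Fin 2)} (h : δ ≤ ‖z‖) : tent δ z = 0 := by
  change ((max 0 (δ - ‖z‖) : ℝ) : ℂ) = 0
  rw [max_eq_left (by linarith), Complex.ofReal_zero]

/-- The integral of a tent function over a disc (for the supremum norm) in the plane
around the origin. -/
noncomputable def tentMass (δ : ℝ) : ℂ :=
  ∫ v in Metric.ball (0 : ℝ × ℝ) δ, tent δ (planeToTorus v)

theorem tentMass_ne_zero {δ : ℝ} (h0 : 0 < δ) (h1 : δ ≤ 1 / 2) : tentMass δ ≠ 0 := by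
  have hc : Continuous fun v : ℝ × ℝ => max 0 (δ - ‖planeToTorus v‖) := by
    have := continuous_planeToTorus
    fun_prop
  have h : tentMass δ = ((∫ v in Metric.ball (0 : ℝ × ℝ) δ,
      max 0 (δ - ‖planeToTorus v‖) : ℝ) : ℂ) := by
    rw [← integral_complex_ofReal]
    rfl
  rw [h, Complex.ofReal_ne_zero]
  refine ne_of_gt ((setIntegral_pos_iff_support_of_nonneg_ae
    (ae_of_all _ fun v => le_max_left _ _) ?_).2 ?_)
  · exact (hc.continuousOn.integrableOn_compact (isCompact_closedBall 0 δ)).mono_set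
      Metric.ball_subset_closedBall
  · refine lt_of_lt_of_le (Metric.measure_ball_pos volume (0 : ℝ × ℝ) h0) (measure_mono ?_)
    intro v hv
    refine ⟨?_, hv⟩
    have hv' : ‖v‖ < δ := by simpa using hv
    rw [Function.mem_support, norm_planeToTorus (by linarith)]
    exact ne_of_gt (lt_max_of_lt_right (by linarith))

/-- Around any point of the lattice, the tent function has the same integral. -/
theorem integral_ball_tent {δ : ℝ} {p : ℝ × ℝ} (hp : planeToTorus p = 0) :
    ∫ v in Metric.ball p δ, tent δ (planeToTorus v) = tentMass δ := by
  have h := (measurePreserving_add_left (volume : Measure (ℝ × ℝ)) p).setIntegral_preimage_emb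
    (MeasurableEquiv.addLeft p).measurableEmbedding (fun v => tent δ (planeToTorus v))
    (Metric.ball p δ)
  rw [← h, tentMass]
  have h2 : (fun x => p + x) ⁻¹' Metric.ball p δ = Metric.ball 0 δ := by
    ext x
    simp
  rw [h2]
  simp only [planeToTorus_add, hp, zero_add]

theorem integral_periodSquare_tent {δ : ℝ} (h1 : δ ≤ 1 / 2) :
    ∫ v in ClosedCurveLift.periodSquare (-1 / 2, -1 / 2), tent δ (planeToTorus v) =
      tentMass δ := by
  have hsq : ClosedCurveLift.periodSquare (-1 / 2, -1 / 2) =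
      Metric.closedBall (0 : ℝ × ℝ) (1 / 2) := by
    have : (0 : ℝ × ℝ) = (0, 0) := rfl
    rw [this, ← closedBall_prod_same, Real.closedBall_eq_Icc, ClosedCurveLift.periodSquare]
    norm_num
  rw [hsq]
  refine setIntegral_eq_of_subset_of_forall_sdiff_eq_zero measurableSet_closedBall
    (Metric.ball_subset_closedBall.trans (Metric.closedBall_subset_closedBall h1)) fun v hv => ?_
  have hv1 : ‖v‖ ≤ 1 / 2 := by simpa using hv.1
  have hv2 : δ ≤ ‖v‖ := by simpa using hv.2
  exact tent_of_le (by rwa [norm_planeToTorus hv1])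

/-! ### Counting the intersections of two closed curves with signs -/

namespace ClosedCurveLift

variable {i j k l : ℤ} (A : ClosedCurveLift i j) (B : ClosedCurveLift k l)

/-- The derivative of `A.diff B`. -/
noncomputable def diffDeriv (q : ℝ × ℝ) : ℝ × ℝ →L[ℝ] ℝ × ℝ :=
  (Matrix.toLin (Module.Basis.finTwoProd ℝ) (Module.Basis.finTwoProd ℝ)
    !![A.dx q.1, -B.dx q.2; A.dy q.1, -B.dy q.2]).toContinuousLinearMap

theorem det_diffDeriv (q : ℝ × ℝ) : (A.diffDeriv B q).det = -A.det B q := by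
  rw [diffDeriv, LinearMap.det_toContinuousLinearMap, LinearMap.det_toLin, Matrix.det_fin_two_of,
    det]
  ring

theorem hasStrictFDerivAt_diff (q : ℝ × ℝ) :
    HasStrictFDerivAt (A.diff B) (A.diffDeriv B q) q := by
  have hstrict : ∀ {f f' : ℝ → ℝ}, (∀ t, HasDerivAt f (f' t) t) → Continuous f' → ∀ t,
      HasStrictDerivAt f (f' t) t := fun h hf' t =>
    hasStrictDerivAt_of_hasDerivAt_of_continuousAt (Filter.Eventually.of_forall h) hf'.continuousAt
  have h1 := (hstrict A.hasDerivAt_x A.continuous_dx q.1).comp_hasStrictFDerivAt q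
    (hasStrictFDerivAt_fst (𝕜 := ℝ))
  have h2 := (hstrict A.hasDerivAt_y A.continuous_dy q.1).comp_hasStrictFDerivAt q
    (hasStrictFDerivAt_fst (𝕜 := ℝ))
  have h3 := (hstrict B.hasDerivAt_x B.continuous_dx q.2).comp_hasStrictFDerivAt q
    (hasStrictFDerivAt_snd (𝕜 := ℝ))
  have h4 := (hstrict B.hasDerivAt_y B.continuous_dy q.2).comp_hasStrictFDerivAt q
    (hasStrictFDerivAt_snd (𝕜 := ℝ))
  refine ((h1.sub h3).prodMk (h2.sub h4)).congr_fderiv ?_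
  rw [diffDeriv, Matrix.toLin_finTwoProd_toContinuousLinearMap]
  ext <;> simp

/-- Near a transverse intersection, the difference of the curves is a local diffeomorphism. -/
theorem exists_nhds_intersection {p : ℝ × ℝ} (hp : A.det B p ≠ 0) {U : Set (ℝ × ℝ)}
    (hU : IsOpen U) (hpU : p ∈ U) :
    ∃ V, IsOpen V ∧ p ∈ V ∧ V ⊆ U ∧ InjOn (A.diff B) V ∧ (∀ q ∈ V, 0 < A.det B q * A.det B p) ∧
      (∀ q ∈ V, dist (A.diff B q) (A.diff B p) < 1 / 2) ∧
      ∃ δ > 0, Metric.ball (A.diff B p) δ ⊆ A.diff B '' V := by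
  have hd : (A.diffDeriv B p).det ≠ 0 := by
    rwa [det_diffDeriv, neg_ne_zero]
  let e := (A.diffDeriv B p).toContinuousLinearEquivOfDetNeZero hd
  have he : HasStrictFDerivAt (A.diff B) (e : ℝ × ℝ →L[ℝ] ℝ × ℝ) p := by
    rw [ContinuousLinearMap.coe_toContinuousLinearEquivOfDetNeZero]
    exact A.hasStrictFDerivAt_diff B p
  let Φ := he.toOpenPartialHomeomorph
  have h1 : IsOpen {q | 0 < A.det B q * A.det B p} :=
    isOpen_lt continuous_const ((A.continuous_det B).mul_const _)
  have h2 : IsOpen {q | dist (A.diff B q) (A.diff B p) < 1 / 2} :=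
    isOpen_lt ((A.continuous_diff B).dist continuous_const) continuous_const
  have hV : IsOpen (Φ.source ∩ U ∩ {q | 0 < A.det B q * A.det B p} ∩
      {q | dist (A.diff B q) (A.diff B p) < 1 / 2}) :=
    ((Φ.open_source.inter hU).inter h1).inter h2
  have hpV : p ∈ Φ.source ∩ U ∩ {q | 0 < A.det B q * A.det B p} ∩
      {q | dist (A.diff B q) (A.diff B p) < 1 / 2} :=
    ⟨⟨⟨he.mem_toOpenPartialHomeomorph_source, hpU⟩, mul_self_pos.2 hp⟩, by simp⟩
  refine ⟨_, hV, hpV, fun q hq => hq.1.1.2, fun q hq r hr hqr => Φ.injOn hq.1.1.1 hr.1.1.1 hqr,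
    fun q hq => hq.1.2, fun q hq => hq.2, ?_⟩
  have h3 := Filter.image_mem_map (m := A.diff B) (hV.mem_nhds hpV)
  rw [he.map_nhds_eq_of_equiv] at h3
  exact Metric.mem_nhds_iff.1 h3

/-- All intersections of the two curves are transverse. -/
def Transverse : Prop := ∀ q, planeToTorus (A.diff B q) = 0 → A.det B q ≠ 0

variable {A B}

/-- Transverse intersections are isolated, so that a period square contains finitely many. -/
theorem Transverse.finite (h : A.Transverse B) (c : ℝ × ℝ) :
    {q ∈ periodSquare c | planeToTorus (A.diff B q) = 0}.Finite := by
  have hcl : IsClosed {q | planeToTorus (A.diff B q) = 0} :=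
    isClosed_eq (continuous_planeToTorus.comp (A.continuous_diff B)) continuous_const
  refine ((isCompact_periodSquare c).inter_right hcl).finite ?_
  rw [isDiscrete_iff_forall_mem_exists_isOpen]
  rintro p ⟨hpK, hp⟩
  obtain ⟨V, hV, hpV, -, hinj, -, hdist, -⟩ := A.exists_nhds_intersection B (h p hp) isOpen_univ
    (mem_univ p)
  refine ⟨V, hV, subset_antisymm ?_ (singleton_subset_iff.2 ⟨hpV, hpK, hp⟩)⟩
  rintro q ⟨hqV, -, hq : planeToTorus _ = 0⟩
  refine hinj hqV hpV (dist_eq_zero.1 ?_)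
  rw [← norm_planeToTorus_of_dist_le hp (hdist q hqV).le, hq, norm_zero]

/-- The intersections of two transverse closed curves, counted with signs, are as many as the
determinant of their bidegrees says: in the degree formula, take for `φ` a tent function so narrow
that the integral is concentrated near the intersections, and change variables there. -/
theorem Transverse.sum_sign (h : A.Transverse B) (c : ℝ × ℝ) (Z : Finset (ℝ × ℝ))
    (hZ : ∀ q, q ∈ Z ↔ q ∈ periodSquare c ∧ planeToTorus (A.diff B q) = 0)
    (hint : ∀ q ∈ Z, q ∈ interior (periodSquare c)) :
    ∑ q ∈ Z, (SignType.sign (A.det B q) : ℤ) = i * l - j * k := by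
  obtain ⟨U, hU, hUd⟩ := Z.finite_toSet.t2_separation
  have hloc : ∀ p : Z, ∃ V, IsOpen V ∧ (p : ℝ × ℝ) ∈ V ∧ V ⊆ U p ∩ interior (periodSquare c) ∧
      InjOn (A.diff B) V ∧ (∀ q ∈ V, 0 < A.det B q * A.det B p) ∧
      (∀ q ∈ V, dist (A.diff B q) (A.diff B p) < 1 / 2) ∧
      ∃ δ > 0, Metric.ball (A.diff B p) δ ⊆ A.diff B '' V := fun p =>
    A.exists_nhds_intersection B (h p ((hZ p).1 p.2).2) ((hU p).2.inter isOpen_interior)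
      ⟨(hU p).1, hint p p.2⟩
  choose V hV hpV hVU hinj hsign hdist δ' hδ' hball using hloc
  -- Away from the chosen neighbourhoods, the curves keep a positive distance.
  obtain ⟨ε, hε, hεle⟩ : ∃ ε : ℝ, 0 < ε ∧ ∀ q ∈ periodSquare c \ ⋃ p, V p,
      ε ≤ ‖planeToTorus (A.diff B q)‖ := by
    refine ((isCompact_periodSquare c).diff (isOpen_iUnion hV)).exists_forall_le'
      (continuous_planeToTorus.comp (A.continuous_diff B)).norm.continuousOn fun q hq => ?_
    refine norm_pos_iff.2 fun h0 => hq.2 ?_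
    exact mem_iUnion.2 ⟨⟨q, (hZ q).2 ⟨hq.1, h0⟩⟩, hpV ⟨q, _⟩⟩
  obtain ⟨δ, hδ0, hδ1, hδε, hδball⟩ : ∃ δ : ℝ, 0 < δ ∧ δ ≤ 1 / 2 ∧ δ ≤ ε ∧ ∀ p, δ ≤ δ' p := by
    have h1 : ∀ r : ℝ, 0 < r → ∀ᶠ δ in nhdsWithin (0 : ℝ) (Ioi 0), δ ≤ r := fun r hr =>
      (eventually_le_nhds hr).filter_mono nhdsWithin_le_nhds
    exact (((eventually_mem_nhdsWithin (a := (0 : ℝ)) (s := Ioi 0)).and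
      ((h1 _ one_half_pos).and ((h1 _ hε).and
        (Filter.eventually_all.2 fun p => h1 _ (hδ' p)))))).exists
  let W : Z → Set (ℝ × ℝ) := fun p => V p ∩ A.diff B ⁻¹' Metric.ball (A.diff B p) δ
  have hWm : ∀ p, MeasurableSet (W p) := fun p =>
    ((hV p).inter (Metric.isOpen_ball.preimage (A.continuous_diff B))).measurableSet
  have himage : ∀ p, A.diff B '' W p = Metric.ball (A.diff B p) δ := fun p => by
    rw [image_inter_preimage, inter_eq_right]
    exact (Metric.ball_subset_ball (hδball p)).trans (hball p)
  have hWsub : ⋃ p ∈ (Finset.univ : Finset Z), W p ⊆ periodSquare c :=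
    iUnion₂_subset fun p _ q hq => interior_subset (hVU p hq.1).2
  have hcont : Continuous fun q => tent δ (planeToTorus (A.diff B q)) * A.det B q := by
    have := A.continuous_diff B
    have := A.continuous_det B
    have := continuous_planeToTorus
    fun_prop
  have hpull : A.pullbackIntegral B c (tent δ) =
      ∑ p : Z, ∫ q in W p, tent δ (planeToTorus (A.diff B q)) * A.det B q := by
    rw [← integral_biUnion_finset _ (fun p _ => hWm p), pullbackIntegral]
    · refine setIntegral_eq_of_subset_of_forall_sdiff_eq_zero
        (isCompact_periodSquare c).measurableSet hWsub fun q hq => ?_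
      rw [tent_of_le, zero_mul]
      by_cases hqV : q ∈ ⋃ p, V p
      · obtain ⟨p, hp⟩ := mem_iUnion.1 hqV
        rw [norm_planeToTorus_of_dist_le ((hZ p).1 p.2).2 (hdist p q hp).le]
        by_contra! hlt
        exact hq.2 (mem_iUnion₂.2 ⟨p, Finset.mem_univ p, hp, hlt⟩)
      · exact hδε.trans (hεle q ⟨hq.1, hqV⟩)
    · intro p _ p' _ hpp'
      refine (hUd p.2 p'.2 (Subtype.coe_ne_coe.2 hpp')).mono ?_ ?_
      · exact fun q hq => (hVU p hq.1).1
      · exact fun q hq => (hVU p' hq.1).1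
    · intro p hp
      exact (hcont.continuousOn.integrableOn_compact (isCompact_periodSquare c)).mono_set
        ((subset_biUnion_of_mem (u := W) (Finset.mem_coe.2 hp)).trans hWsub)
  have hterm : ∀ p : Z, ∫ q in W p, tent δ (planeToTorus (A.diff B q)) * A.det B q =
      ((SignType.sign (A.det B p) : ℤ) : ℂ) * tentMass δ := by
    intro p
    have hp0 := h p ((hZ p).1 p.2).2
    rw [← integral_ball_tent ((hZ p).1 p.2).2, ← himage,
      integral_image_eq_integral_abs_det_fderiv_smul volume (hWm p)
        (fun q _ => (A.hasStrictFDerivAt_diff B q).hasFDerivAt.hasFDerivWithinAt)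
        ((hinj p).mono inter_subset_left), ← integral_const_mul]
    refine setIntegral_congr_fun (hWm p) fun q hq => ?_
    have hs := hsign p q hq.1
    simp only [det_diffDeriv, abs_neg, Complex.real_smul]
    rcases lt_or_gt_of_ne hp0 with hneg | hpos
    · rw [sign_neg hneg, abs_of_neg (neg_of_mul_pos_left hs hneg.le)]
      simp
      ring
    · rw [sign_pos hpos, abs_of_pos (pos_of_mul_pos_left hs hpos.le)]
      simp
      ring
  rw [A.pullbackIntegral_eq B c (-1 / 2, -1 / 2), integral_periodSquare_tent hδ1,
    Finset.sum_congr rfl fun p _ => hterm p, ← Finset.sum_mul] at hpull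
  have hfin := mul_right_cancel₀ (tentMass_ne_zero hδ0 hδ1) hpull
  rw [← Finset.sum_coe_sort Z (fun q => (SignType.sign (A.det B q) : ℤ))]
  exact_mod_cast hfin.symm

end ClosedCurveLift

/-! ### Lifts of smooth loops, and the Goldman sum -/

/-- The velocity of a curve in the unit circle is tangent to the circle. -/
theorem deriv_div_self_eq {z : ℝ → Circle} (hz : Differentiable ℝ fun t => (z t : ℂ)) (t : ℝ) :
    deriv (fun t => (z t : ℂ)) t / z t = (deriv (fun t => (z t : ℂ)) t / z t).im * Complex.I := by
  have h1 := (hz t).hasDerivAt.norm_sq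
  have h2 : (fun t => ‖(z t : ℂ)‖ ^ 2) = fun _ => (1 : ℝ) := by
    funext t
    rw [Circle.norm_coe, one_pow]
  rw [h2] at h1
  have h3 := h1.unique (hasDerivAt_const t (1 : ℝ))
  have h4 : (deriv (fun t => (z t : ℂ)) t / z t).re = 0 := by
    rw [div_eq_mul_inv, ← Circle.coe_inv, Circle.coe_inv_eq_conj]
    rw [Complex.inner] at h3
    linarith
  apply Complex.ext <;> simp [h4]

/-- A curve in the unit circle is lifted to the line by integrating its angular velocity. -/
theorem exists_smooth_lift {z : ℝ → Circle} (hz : ContDiff ℝ 1 fun t => (z t : ℂ)) :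
    ∃ f f' : ℝ → ℝ, (∀ t, HasDerivAt f (f' t) t) ∧ Continuous f' ∧ (∀ t, z t = unitExp (f t)) ∧
      ∀ t, (deriv (fun t => (z t : ℂ)) t / z t).im = 2 * Real.pi * f' t := by
  have hz0 : ∀ t, (z t : ℂ) ≠ 0 := fun t => Circle.coe_ne_zero _
  have hzd : Differentiable ℝ fun t => (z t : ℂ) := hz.differentiable one_ne_zero
  let f' : ℝ → ℝ := fun t => (deriv (fun t => (z t : ℂ)) t / z t).im / (2 * Real.pi)
  have hf' : Continuous f' := (Complex.continuous_im.comp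
    ((hz.continuous_deriv le_rfl).div hz.continuous hz0)).div_const _
  let f : ℝ → ℝ := fun t => Complex.arg (z 0) / (2 * Real.pi) + ∫ r in (0 : ℝ)..t, f' r
  have hf : ∀ t, HasDerivAt f (f' t) t := fun t =>
    (intervalIntegral.integral_hasDerivAt_right (hf'.intervalIntegrable _ _)
      (hf'.stronglyMeasurableAtFilter _ _) hf'.continuousAt).const_add _
  have hmul : ∀ t, 2 * Real.pi * f' t = (deriv (fun t => (z t : ℂ)) t / z t).im := fun t =>
    mul_div_cancel₀ _ (by positivity)
  refine ⟨f, f', hf, hf', fun t => ?_, fun t => (hmul t).symm⟩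
  -- The quotient of the curve and the exponential of the lift has derivative zero.
  let g : ℝ → ℂ := fun t => z t * Complex.exp (-(2 * Real.pi * Complex.I * f t))
  have hg : ∀ t, HasDerivAt g 0 t := fun t => by
    have h1 := (hzd t).hasDerivAt.mul
      ((hf t).ofReal_comp.const_mul (2 * Real.pi * Complex.I)).neg.cexp
    refine h1.congr_deriv ?_
    have h2 := deriv_div_self_eq hzd t
    rw [← hmul, div_eq_iff (hz0 t)] at h2
    rw [h2]
    push_cast
    ring
  have hconst : g t = g 0 :=
    is_const_of_deriv_eq_zero (fun t => (hg t).differentiableAt) (fun t => (hg t).deriv) t 0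
  have hexp : ∀ t, g t = (z t * (unitExp (f t))⁻¹ : Circle) := fun t => by
    rw [← unitExp_neg, unitExp_eq_exp, Circle.coe_mul, Circle.coe_exp]
    simp only [g]
    congr 2
    push_cast
    ring
  have h0 : unitExp (f 0) = z 0 := by
    simp only [f, intervalIntegral.integral_same, add_zero]
    rw [unitExp_eq_exp, mul_div_cancel₀ _ (by positivity), Circle.exp_arg]
  rw [hexp, hexp, h0, mul_inv_cancel, Circle.coe_inj] at hconst
  exact mul_inv_eq_one.1 hconst

namespace Torus

variable {γ α β : FreeLoop Torus} {i j k l : ℤ}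

theorem IsSmoothLoop.contDiff_fst (h : IsSmoothLoop γ) :
    ContDiff ℝ 1 fun t : ℝ => ((γ (t : UnitAddCircle)).1 : ℂ) := by
  have := finrank_real_complex_fact'
  have h1 : ContMDiff 𝓘(ℝ, ℝ) 𝓘(ℝ, ℂ) ∞ fun t : ℝ => ((γ (t : UnitAddCircle)).1 : ℂ) :=
    (contMDiff_coe_sphere (E := ℂ) (n := 1)).comp (contMDiff_fst.comp h)
  exact h1.contDiff.of_le (by norm_cast)

theorem IsSmoothLoop.contDiff_snd (h : IsSmoothLoop γ) :
    ContDiff ℝ 1 fun t : ℝ => ((γ (t : UnitAddCircle)).2 : ℂ) := by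
  have := finrank_real_complex_fact'
  have h1 : ContMDiff 𝓘(ℝ, ℝ) 𝓘(ℝ, ℂ) ∞ fun t : ℝ => ((γ (t : UnitAddCircle)).2 : ℂ) :=
    (contMDiff_coe_sphere (E := ℂ) (n := 1)).comp (contMDiff_snd.comp h)
  exact h1.contDiff.of_le (by norm_cast)

/-- `A` is a lift of the loop `γ` to the plane. -/
structure IsLift (A : ClosedCurveLift i j) (γ : FreeLoop Torus) : Prop where
  fst : ∀ t : ℝ, (γ (t : UnitAddCircle)).1 = unitExp (A.x t)
  snd : ∀ t : ℝ, (γ (t : UnitAddCircle)).2 = unitExp (A.y t)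
  velocity : ∀ t : ℝ, velocity γ (t : UnitAddCircle) =
    (2 * Real.pi * A.dx t, 2 * Real.pi * A.dy t)

theorem IsSmoothLoop.exists_lift (h : IsSmoothLoop γ) (hγ : HasBidegree γ i j) :
    ∃ A : ClosedCurveLift i j, IsLift A γ := by
  obtain ⟨x, dx, hx, hdx, hx1, hx2⟩ :=
    exists_smooth_lift (z := fun t : ℝ => (γ (t : UnitAddCircle)).1) h.contDiff_fst
  obtain ⟨y, dy, hy, hdy, hy1, hy2⟩ :=
    exists_smooth_lift (z := fun t : ℝ => (γ (t : UnitAddCircle)).2) h.contDiff_snd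
  have hxc : Continuous x := continuous_iff_continuousAt.2 fun t => (hx t).continuousAt
  have hyc : Continuous y := continuous_iff_continuousAt.2 fun t => (hy t).continuousAt
  refine ⟨⟨x, y, dx, dy, hx, hy, hdx, hdy, hγ.fst.lift_add_one hxc hx1,
    hγ.snd.lift_add_one hyc hy1⟩, hx1, hy1, fun t => ?_⟩
  refine Prod.ext ?_ ?_
  · rw [← hx2 t, Torus.velocity]
    have := deriv_comp_const_add (fun r : ℝ => ((γ (r : UnitAddCircle)).1 : ℂ)) t 0
    simp only [AddCircle.coe_add, add_zero] at this
    rw [this]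
  · rw [← hy2 t, Torus.velocity]
    have := deriv_comp_const_add (fun r : ℝ => ((γ (r : UnitAddCircle)).2 : ℂ)) t 0
    simp only [AddCircle.coe_add, add_zero] at this
    rw [this]

variable {A : ClosedCurveLift i j} {B : ClosedCurveLift k l}

theorem IsLift.velocityDet (hA : IsLift A α) (hB : IsLift B β) (q : ℝ × ℝ) :
    velocityDet α β (q.1 : UnitAddCircle) (q.2 : UnitAddCircle) =
      (2 * Real.pi) ^ 2 * A.det B q := by
  rw [Torus.velocityDet, hA.velocity, hB.velocity, ClosedCurveLift.det]
  ring

theorem unitExp_eq_unitExp_iff {x y : ℝ} :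
    unitExp x = unitExp y ↔ ((x - y : ℝ) : UnitAddCircle) = 0 := by
  rw [unitExp, unitExp, (AddCircle.injective_toCircle one_ne_zero).eq_iff, AddCircle.coe_sub,
    sub_eq_zero]

theorem IsLift.planeToTorus_diff_eq_zero_iff (hA : IsLift A α) (hB : IsLift B β) (q : ℝ × ℝ) :
    planeToTorus (A.diff B q) = 0 ↔ α (q.1 : UnitAddCircle) = β (q.2 : UnitAddCircle) := by
  rw [Prod.ext_iff, hA.fst, hA.snd, hB.fst, hB.snd, unitExp_eq_unitExp_iff, unitExp_eq_unitExp_iff,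
    funext_iff, Fin.forall_fin_two]
  rfl

theorem TransversePair.transverse_lift (h : TransversePair α β) (hA : IsLift A α)
    (hB : IsLift B β) : A.Transverse B := by
  intro q hq
  have h1 := h.transverse _ _ ((hA.planeToTorus_diff_eq_zero_iff hB q).1 hq)
  rw [hA.velocityDet hB] at h1
  exact right_ne_zero_of_mul h1

theorem exists_mem_periodSquare (c : ℝ × ℝ) (p : UnitAddCircle × UnitAddCircle) :
    ∃ q ∈ ClosedCurveLift.periodSquare c,
      ((q.1 : UnitAddCircle), (q.2 : UnitAddCircle)) = p := by
  obtain ⟨s, hs, hs'⟩ := exists_mem_Ico_coe_eq c.1 p.1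
  obtain ⟨t, ht, ht'⟩ := exists_mem_Ico_coe_eq c.2 p.2
  exact ⟨(s, t), ⟨Ico_subset_Icc_self hs, Ico_subset_Icc_self ht⟩, Prod.ext hs' ht'⟩

theorem TransversePair.finite_intersection (h : TransversePair α β) :
    Finite (Intersection α β) := by
  obtain ⟨i, j, hα⟩ := exists_hasBidegree α
  obtain ⟨k, l, hβ⟩ := exists_hasBidegree β
  obtain ⟨A, hA⟩ := h.smooth_left.exists_lift hα
  obtain ⟨B, hB⟩ := h.smooth_right.exists_lift hβ
  refine Set.Finite.subset (((h.transverse_lift hA hB).finite 0).image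
    fun q => ((q.1 : UnitAddCircle), (q.2 : UnitAddCircle))) ?_
  intro p hp
  obtain ⟨q, hq, rfl⟩ := exists_mem_periodSquare 0 p
  exact ⟨q, ⟨hq, (hA.planeToTorus_diff_eq_zero_iff hB q).2 hp⟩, rfl⟩

theorem exists_coe_notMem {F : Set UnitAddCircle} (hF : F.Finite) :
    ∃ c : ℝ, (c : UnitAddCircle) ∉ F := by
  have := (Ico_infinite (show (0 : ℝ) < 0 + 1 by simp)).to_subtype
  have : Infinite UnitAddCircle :=
    Infinite.of_injective _ (AddCircle.equivIco (1 : ℝ) 0).symm.injective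
  obtain ⟨x, hx⟩ := hF.exists_notMem
  obtain ⟨c, rfl⟩ := QuotientAddGroup.mk_surjective x
  exact ⟨c, hx⟩

theorem mem_Ioo_of_mem_Icc_of_coe_ne {c s : ℝ} (hs : s ∈ Icc c (c + 1))
    (h : (s : UnitAddCircle) ≠ c) : s ∈ Ioo c (c + 1) := by
  refine ⟨lt_of_le_of_ne hs.1 ?_, lt_of_le_of_ne hs.2 ?_⟩
  · rintro rfl
    exact h rfl
  · rintro rfl
    exact h (AddCircle.coe_add_period 1 c)

/-- The algebraic intersection number of transverse loops is the determinant of their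
bidegrees. -/
theorem TransversePair.sum_sgn (h : TransversePair α β) (hα : HasBidegree α i j)
    (hβ : HasBidegree β k l) [Fintype (Intersection α β)] :
    ∑ p : Intersection α β, p.sgn = ((i * l - j * k : ℤ) : ℚ) := by
  obtain ⟨A, hA⟩ := h.smooth_left.exists_lift hα
  obtain ⟨B, hB⟩ := h.smooth_right.exists_lift hβ
  have htr := h.transverse_lift hA hB
  have hzero := hA.planeToTorus_diff_eq_zero_iff hB
  -- A period square without intersections on its boundary.
  obtain ⟨c₁, hc₁⟩ := exists_coe_notMem (finite_range fun p : Intersection α β => p.1.1)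
  obtain ⟨c₂, hc₂⟩ := exists_coe_notMem (finite_range fun p : Intersection α β => p.1.2)
  let Z := (htr.finite (c₁, c₂)).toFinset
  have hZ : ∀ q, q ∈ Z ↔ q ∈ ClosedCurveLift.periodSquare (c₁, c₂) ∧
      planeToTorus (A.diff B q) = 0 := fun q => (htr.finite (c₁, c₂)).mem_toFinset
  have hIoo : ∀ q ∈ Z, q.1 ∈ Ioo c₁ (c₁ + 1) ∧ q.2 ∈ Ioo c₂ (c₂ + 1) := by
    intro q hq
    obtain ⟨⟨h1, h2⟩, h3⟩ := (hZ q).1 hq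
    let p : Intersection α β := ⟨(q.1, q.2), (hzero q).1 h3⟩
    exact ⟨mem_Ioo_of_mem_Icc_of_coe_ne h1 fun h => hc₁ ⟨p, h⟩,
      mem_Ioo_of_mem_Icc_of_coe_ne h2 fun h => hc₂ ⟨p, h⟩⟩
  rw [← htr.sum_sign (c₁, c₂) Z hZ fun q hq => ?_]
  · rw [Int.cast_sum]
    symm
    refine Finset.sum_bij (fun q hq => ⟨(q.1, q.2), (hzero q).1 ((hZ q).1 hq).2⟩)
      (fun _ _ => Finset.mem_univ _) (fun q hq r hr hqr => ?_) (fun p _ => ?_) (fun q hq => ?_)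
    · have hqr' := congrArg Subtype.val hqr
      obtain ⟨e1, e2⟩ := Prod.ext_iff.1 hqr'
      obtain ⟨q1, q2⟩ := hIoo q hq
      obtain ⟨r1, r2⟩ := hIoo r hr
      exact Prod.ext
        ((AddCircle.coe_eq_coe_iff_of_mem_Ico (Ioo_subset_Ico_self q1)
          (Ioo_subset_Ico_self r1)).1 e1)
        ((AddCircle.coe_eq_coe_iff_of_mem_Ico (Ioo_subset_Ico_self q2)
          (Ioo_subset_Ico_self r2)).1 e2)
    · obtain ⟨⟨s, t⟩, hst⟩ := p
      obtain ⟨q, hq, hqp⟩ := exists_mem_periodSquare (c₁, c₂) (s, t)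
      obtain ⟨rfl, rfl⟩ := Prod.ext_iff.1 hqp
      exact ⟨q, (hZ q).2 ⟨hq, (hzero q).2 hst⟩, rfl⟩
    · change _ = ((SignType.sign (velocityDet α β q.1 q.2) : ℤ) : ℚ)
      rw [hA.velocityDet hB, sign_mul, sign_pos (show (0 : ℝ) < (2 * Real.pi) ^ 2 by positivity),
        one_mul]
  · rw [ClosedCurveLift.periodSquare, interior_prod_eq, interior_Icc, interior_Icc]
    exact hIoo q hq

theorem TransversePair.goldman_sum (h : TransversePair α β) (hα : HasBidegree α i j)
    (hβ : HasBidegree β k l) :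
    ∑ᶠ p : Intersection α β, p.sgn • basisVec p.concatClass =
      ((i * l - j * k : ℤ) : ℚ) • basisVec (word (i + k) (j + l)) := by
  have := h.finite_intersection
  have := Fintype.ofFinite (Intersection α β)
  rw [finsum_eq_sum_of_fintype]
  simp only [concatClass_eq hα hβ]
  rw [← Finset.sum_smul, h.sum_sgn hα hβ]

/-! ### Transverse representatives of pairs of classes -/

/-- The loop `t ↦ (exp (2 π i (u + i t)), exp (2 π i (v + j t)))`. -/
noncomputable def linearLoop (i j : ℤ) (u v : ℝ) : FreeLoop Torus where
  toFun t := (unitExp u * t.toCircle ^ i, unitExp v * t.toCircle ^ j)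
  continuous_toFun := by
    have h := AddCircle.continuous_toCircle (T := 1)
    exact (continuous_const.mul (h.zpow i)).prodMk (continuous_const.mul (h.zpow j))

theorem hasBidegree_linearLoop (i j : ℤ) (u v : ℝ) : HasBidegree (linearLoop i j u v) i j :=
  ⟨⟨ContinuousMap.const _ u, fun _ => mul_comm _ _⟩,
    ⟨ContinuousMap.const _ v, fun _ => mul_comm _ _⟩⟩

theorem linearLoop_coe (i j : ℤ) (u v t : ℝ) :
    linearLoop i j u v (t : UnitAddCircle) = (unitExp (u + i * t), unitExp (v + j * t)) := by
  rw [unitExp_add, unitExp_add, unitExp_int_mul, unitExp_int_mul]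
  rfl

theorem isSmoothLoop_linearLoop (i j : ℤ) (u v : ℝ) : IsSmoothLoop (linearLoop i j u v) := by
  unfold IsSmoothLoop
  simp only [linearLoop_coe, unitExp_eq_exp]
  refine ContMDiff.prodMk ?_ ?_ <;>
  · refine contMDiff_circleExp.comp (ContDiff.contMDiff ?_)
    fun_prop

theorem velocity_linearLoop (i j : ℤ) (u v : ℝ) (s : UnitAddCircle) :
    velocity (linearLoop i j u v) s = (2 * Real.pi * i, 2 * Real.pi * j) := by
  have key : ∀ (n : ℤ) (w s : ℝ),
      (deriv (fun r : ℝ => (unitExp (w + n * (s + r)) : ℂ)) 0 / unitExp (w + n * s)).im =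
        2 * Real.pi * n := by
    intro n w s
    have h1 : HasDerivAt (fun r : ℝ => (unitExp (w + n * (s + r)) : ℂ))
        (unitExp (w + n * s) * (2 * Real.pi * n * Complex.I)) 0 := by
      simp only [unitExp_eq_exp, Circle.coe_exp]
      have h2 : HasDerivAt (fun r : ℝ => 2 * Real.pi * (w + n * (s + r))) (2 * Real.pi * n) 0 := by
        have := ((((hasDerivAt_id (0 : ℝ)).const_add s).const_mul (n : ℝ)).const_add w).const_mul
          (2 * Real.pi)
        simpa using this
      have h3 := (h2.ofReal_comp.mul_const Complex.I).cexp
      simpa using h3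
    rw [h1.deriv, mul_div_cancel_left₀ _ (Circle.coe_ne_zero _)]
    simp
  obtain ⟨s, rfl⟩ := QuotientAddGroup.mk_surjective s
  change velocity _ (s : UnitAddCircle) = _
  simp only [velocity, ← AddCircle.coe_add, linearLoop_coe]
  exact Prod.ext (key i u s) (key j v s)

/-- Two linear loops with linearly dependent bidegrees are disjoint after a translation of one of
them: some nonzero integral linear form vanishes on both directions, and the translation moves its
value on one of the loops to `1 / 2` modulo the integers. -/
theorem exists_disjoint_linearLoop (h : i * l - j * k = 0) :
    ∃ u v : ℝ, ∀ s t, linearLoop i j u v s ≠ linearLoop k l 0 0 t := by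
  obtain ⟨m, n, hmn, h1, h2⟩ : ∃ m n : ℤ, (m ≠ 0 ∨ n ≠ 0) ∧ m * i + n * j = 0 ∧
      m * k + n * l = 0 := by
    by_cases h0 : j ≠ 0 ∨ i ≠ 0
    · exact ⟨-j, i, by simpa using h0, by ring, by linarith⟩
    · obtain ⟨rfl, rfl⟩ : j = 0 ∧ i = 0 := by simpa using h0
      by_cases h0' : l ≠ 0 ∨ k ≠ 0
      · exact ⟨-l, k, by simpa using h0', by ring, by ring⟩
      · obtain ⟨rfl, rfl⟩ : l = 0 ∧ k = 0 := by simpa using h0'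
        exact ⟨1, 0, by simp, by simp, by simp⟩
  obtain ⟨u, v, huv⟩ : ∃ u v : ℝ, m * u + n * v = 1 / 2 := by
    rcases hmn with hm | hn
    · have : (m : ℝ) ≠ 0 := by exact_mod_cast hm
      exact ⟨1 / 2 / m, 0, by field_simp; ring⟩
    · have : (n : ℝ) ≠ 0 := by exact_mod_cast hn
      exact ⟨0, 1 / 2 / n, by field_simp; ring⟩
  refine ⟨u, v, fun s t hst => ?_⟩
  obtain ⟨s, rfl⟩ := QuotientAddGroup.mk_surjective s
  obtain ⟨t, rfl⟩ := QuotientAddGroup.mk_surjective t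
  have hst' := (linearLoop_coe i j u v s).symm.trans (hst.trans (linearLoop_coe k l 0 0 t))
  obtain ⟨e1, e2⟩ := Prod.ext_iff.1 hst'
  obtain ⟨a, ha⟩ := unitExp_eq_iff.1 e1
  obtain ⟨b, hb⟩ := unitExp_eq_iff.1 e2
  have h1' : (m * i + n * j : ℝ) = 0 := by exact_mod_cast h1
  have h2' : (m * k + n * l : ℝ) = 0 := by exact_mod_cast h2
  have h3 : (1 : ℝ) = 2 * (m * a + n * b) := by
    linear_combination (-2) * huv + 2 * m * ha + 2 * n * hb - 2 * s * h1' + 2 * t * h2'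
  have h4 : (1 : ℤ) = 2 * (m * a + n * b) := by exact_mod_cast h3
  omega

theorem exists_transversePair (i j k l : ℤ) :
    ∃ α β : FreeLoop Torus, TransversePair α β ∧ HasBidegree α i j ∧ HasBidegree β k l := by
  by_cases h : i * l - j * k = 0
  · obtain ⟨u, v, huv⟩ := exists_disjoint_linearLoop h
    exact ⟨_, _, ⟨isSmoothLoop_linearLoop i j u v, isSmoothLoop_linearLoop k l 0 0,
      fun s t hst => (huv s t hst).elim⟩, hasBidegree_linearLoop _ _ _ _,
      hasBidegree_linearLoop _ _ _ _⟩
  · refine ⟨_, _, ⟨isSmoothLoop_linearLoop i j 0 0, isSmoothLoop_linearLoop k l 0 0,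
      fun s t _ => ?_⟩, hasBidegree_linearLoop _ _ _ _, hasBidegree_linearLoop _ _ _ _⟩
    have h1 : velocityDet (linearLoop i j 0 0) (linearLoop k l 0 0) s t =
        (2 * Real.pi) ^ 2 * ((i * l - j * k : ℤ) : ℝ) := by
      rw [velocityDet, velocity_linearLoop, velocity_linearLoop]
      push_cast
      ring
    rw [h1]
    exact mul_ne_zero (by positivity) (by exact_mod_cast h)

end Torus

end

/-! ### The Goldman Lie algebra of the torus and its generators -/

namespace IsLieBracket

variable {V : Type*} [AddCommGroup V] [Module ℚ V] {B : V →ₗ[ℚ] V →ₗ[ℚ] V} (h : IsLieBracket B)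
  {S : Set V}

theorem subset_generate : S ⊆ h.generate S :=
  letI := h.lieRing
  letI := h.lieAlgebra
  LieSubalgebra.subset_lieSpan

theorem apply_mem_generate {x y : V} (hx : x ∈ h.generate S) (hy : y ∈ h.generate S) :
    B x y ∈ h.generate S :=
  letI := h.lieRing
  letI := h.lieAlgebra
  (LieSubalgebra.lieSpan ℚ V S).lie_mem hx hy

theorem generate_le {N : Submodule ℚ V} (hS : S ⊆ N) (hN : ∀ x ∈ N, ∀ y ∈ N, B x y ∈ N) :
    h.generate S ≤ N := by
  let := h.lieRing
  let := h.lieAlgebra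
  exact LieSubalgebra.lieSpan_le (K := { N with lie_mem' := fun hx hy => hN _ hx _ hy }).2 hS

end IsLieBracket

namespace Torus

/-- The free homotopy classes on the torus, indexed by their bidegrees. -/
noncomputable def wordEquiv : ℤ × ℤ ≃ FreeLoopClass Torus :=
  Equiv.ofBijective (fun p => word p.1 p.2)
    ⟨fun _ _ h => Prod.ext (word_injective h).1 (word_injective h).2,
      fun c => let ⟨i, j, h⟩ := exists_word_eq c; ⟨(i, j), h⟩⟩

theorem wordEquiv_symm_word (i j : ℤ) : wordEquiv.symm (word i j) = (i, j) :=
  wordEquiv.symm_apply_apply (i, j)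

/-- The bilinear map with `[a ^ i b ^ j, a ^ k b ^ l] = (i l - j k) a ^ (i + k) b ^ (j + l)`. -/
noncomputable def bracket : GoldmanSpace →ₗ[ℚ] GoldmanSpace →ₗ[ℚ] GoldmanSpace :=
  Finsupp.lift _ ℚ _ fun c => Finsupp.lift _ ℚ _ fun d =>
    (((wordEquiv.symm c).1 * (wordEquiv.symm d).2 - (wordEquiv.symm c).2 * (wordEquiv.symm d).1 :
      ℤ) : ℚ) • basisVec (wordEquiv (wordEquiv.symm c + wordEquiv.symm d))

theorem bracket_word (i j k l : ℤ) :
    bracket (basisVec (word i j)) (basisVec (word k l)) =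
      ((i * l - j * k : ℤ) : ℚ) • basisVec (word (i + k) (j + l)) := by
  simp only [bracket, basisVec, Finsupp.lift_apply]
  rw [Finsupp.sum_single_index (by simp), one_smul, Finsupp.lift_apply,
    Finsupp.sum_single_index (by simp), one_smul, wordEquiv_symm_word, wordEquiv_symm_word]
  rfl

theorem isGoldmanBracket_bracket : IsGoldmanBracket bracket := by
  intro α β h
  obtain ⟨i, j, hα⟩ := exists_hasBidegree α
  obtain ⟨k, l, hβ⟩ := exists_hasBidegree β
  rw [h.goldman_sum hα hβ, hα.toClass_eq, hβ.toClass_eq, bracket_word]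

theorem bilin_ext {B B' : GoldmanSpace →ₗ[ℚ] GoldmanSpace →ₗ[ℚ] GoldmanSpace}
    (h : ∀ i j k l, B (basisVec (word i j)) (basisVec (word k l)) =
      B' (basisVec (word i j)) (basisVec (word k l))) : B = B' := by
  refine Finsupp.lhom_ext' fun c => LinearMap.ext_ring (Finsupp.lhom_ext' fun d =>
    LinearMap.ext_ring ?_)
  obtain ⟨i, j, rfl⟩ := exists_word_eq c
  obtain ⟨k, l, rfl⟩ := exists_word_eq d
  exact h i j k l

theorem IsGoldmanBracket.unique {B B' : GoldmanSpace →ₗ[ℚ] GoldmanSpace →ₗ[ℚ] GoldmanSpace}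
    (h : IsGoldmanBracket B) (h' : IsGoldmanBracket B') : B = B' := by
  refine bilin_ext fun i j k l => ?_
  obtain ⟨α, β, hαβ, hα, hβ⟩ := exists_transversePair i j k l
  rw [← hα.toClass_eq, ← hβ.toClass_eq, h α β hαβ, h' α β hαβ]

theorem span_word : Submodule.span ℚ (Set.range fun p : ℤ × ℤ => basisVec (word p.1 p.2)) = ⊤ := by
  rw [eq_top_iff]
  intro x _
  induction x using Finsupp.induction_linear with
  | zero => exact zero_mem _
  | add x y hx hy => exact add_mem (hx trivial) (hy trivial)
  | single c r =>
    obtain ⟨i, j, rfl⟩ := exists_word_eq c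
    have h : Finsupp.single (word i j) r = r • basisVec (word i j) := by simp [basisVec]
    rw [h]
    exact Submodule.smul_mem _ _ (Submodule.subset_span ⟨(i, j), rfl⟩)

/-- To prove a property of all vectors that is preserved by linear combinations, it suffices to
prove it for the classes `a ^ i b ^ j`. -/
theorem word_induction {p : GoldmanSpace → Prop} (x : GoldmanSpace)
    (word : ∀ i j, p (basisVec (word i j))) (zero : p 0) (add : ∀ x y, p x → p y → p (x + y))
    (smul : ∀ (r : ℚ) x, p x → p (r • x)) : p x := by
  have hx : x ∈ Submodule.span ℚ (Set.range fun p : ℤ × ℤ => basisVec (Torus.word p.1 p.2)) := by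
    rw [span_word]
    trivial
  induction hx using Submodule.span_induction with
  | mem x hx =>
    obtain ⟨q, rfl⟩ := hx
    exact word q.1 q.2
  | zero => exact zero
  | add x y _ _ hx hy => exact add x y hx hy
  | smul r x _ hx => exact smul r x hx

theorem isLieBracket_bracket : IsLieBracket bracket where
  self x := by
    have h : bracket.flip = -bracket := by
      refine bilin_ext fun i j k l => ?_
      rw [LinearMap.flip_apply, LinearMap.neg_apply, LinearMap.neg_apply, bracket_word,
        bracket_word, ← neg_smul, add_comm k i, add_comm l j]
      congr 1
      push_cast
      ring
    exact self_eq_neg.1 (LinearMap.congr_fun₂ h x x)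
  jacobi x y z := by
    induction x using word_induction with
    | zero => simp
    | add x x' h h' =>
      simp only [map_add, LinearMap.add_apply]
      refine Eq.trans ?_ ((congrArg₂ (· + ·) h h').trans (add_zero 0))
      abel
    | smul r x h => simp only [map_smul, LinearMap.smul_apply, ← smul_add, h, smul_zero]
    | word i j =>
      induction y using word_induction with
      | zero => simp
      | add x x' h h' =>
        simp only [map_add, LinearMap.add_apply]
        refine Eq.trans ?_ ((congrArg₂ (· + ·) h h').trans (add_zero 0))
        abel
      | smul r x h => simp only [map_smul, LinearMap.smul_apply, ← smul_add, h, smul_zero]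
      | word k l =>
        induction z using word_induction with
        | zero => simp
        | add x x' h h' =>
          simp only [map_add, LinearMap.add_apply]
          refine Eq.trans ?_ ((congrArg₂ (· + ·) h h').trans (add_zero 0))
          abel
        | smul r x h => simp only [map_smul, LinearMap.smul_apply, ← smul_add, h, smul_zero]
        | word m n =>
          simp only [bracket_word, map_smul, smul_smul]
          rw [show k + (m + i) = i + (k + m) by ring, show l + (n + j) = j + (l + n) by ring,
            show m + (i + k) = i + (k + m) by ring, show n + (j + l) = j + (l + n) by ring,
            ← add_smul, ← add_smul]
          convert zero_smul ℚ _
          push_cast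
          ring

/-- The span of the classes of non-contractible loops. -/
noncomputable def nontrivialSpan : Submodule ℚ GoldmanSpace :=
  Submodule.span ℚ (basisVec '' {c | c ≠ word 0 0})

theorem word_mem_nontrivialSpan {i j : ℤ} (h : (i, j) ≠ (0, 0)) :
    basisVec (word i j) ∈ nontrivialSpan :=
  Submodule.subset_span ⟨_, fun h' => h (Prod.ext (word_injective h').1 (word_injective h').2), rfl⟩

/-- Brackets never involve the class of contractible loops, because the determinant of two
opposite vectors vanishes. -/
theorem bracket_mem_nontrivialSpan (x y : GoldmanSpace) : bracket x y ∈ nontrivialSpan := by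
  induction x using word_induction with
  | zero => simp
  | add x x' h h' => simpa using add_mem h h'
  | smul r x h => simpa using Submodule.smul_mem _ r h
  | word i j =>
    induction y using word_induction with
    | zero => simp
    | add x x' h h' => simpa using add_mem h h'
    | smul r x h => simpa using Submodule.smul_mem _ r h
    | word k l =>
      rw [bracket_word]
      by_cases h : (i + k, j + l) = (0, 0)
      · obtain ⟨h1, h2⟩ := Prod.ext_iff.1 h
        have h3 : i * l - j * k = 0 := by
          linear_combination l * h1 - k * h2
        rw [h3, Int.cast_zero, zero_smul]
        exact zero_mem _
      · exact Submodule.smul_mem _ _ (word_mem_nontrivialSpan h)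

/-- Bracketing with `a`, `b` and their inverses moves between neighbouring points of the lattice,
except along the line through the origin in the direction of the move. Every nonzero lattice
point is reached. -/
theorem nontrivialSpan_le {N : Submodule ℚ GoldmanSpace}
    (hN : ∀ x ∈ N, ∀ y ∈ N, bracket x y ∈ N) (ha : basisVec (word 1 0) ∈ N)
    (hb : basisVec (word 0 1) ∈ N) (ha' : basisVec (word (-1) 0) ∈ N)
    (hb' : basisVec (word 0 (-1)) ∈ N) : nontrivialSpan ≤ N := by
  have step : ∀ {i j k l m n : ℤ}, basisVec (word i j) ∈ N → basisVec (word k l) ∈ N →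
      i * l - j * k ≠ 0 → i + k = m → j + l = n → basisVec (word m n) ∈ N := by
    rintro i j k l _ _ h1 h2 h0 rfl rfl
    have h := hN _ h1 _ h2
    rw [bracket_word] at h
    exact (N.smul_mem_iff (by exact_mod_cast h0)).1 h
  have h1 : ∀ l, basisVec (word 1 l) ∈ N := by
    intro l
    induction l using Int.induction_on with
    | zero => exact ha
    | succ l ih => exact step hb ih (by simp) (by simp) (by ring)
    | pred l ih => exact step hb' ih (by simp) (by simp) (by ring)
  have h2 : ∀ k l, l ≠ 0 → basisVec (word k l) ∈ N := by
    intro k l hl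
    induction k using Int.induction_on with
    | zero => exact step ha' (h1 l) (by simpa using hl) (by simp) (by simp)
    | succ k ih => exact step ha ih (by simpa using hl) (by ring) (by simp)
    | pred k ih => exact step ha' ih (by simpa using hl) (by ring) (by simp)
  refine Submodule.span_le.2 ?_
  rintro _ ⟨c, hc, rfl⟩
  obtain ⟨k, l, rfl⟩ := exists_word_eq c
  by_cases hl : l = 0
  · subst hl
    have hk : k ≠ 0 := by
      rintro rfl
      exact hc rfl
    exact step hb' (h2 k 1 one_ne_zero) (by simpa using hk) (by simp) (by simp)
  · exact h2 k l hl

theorem nontrivialSpan_le_generate {S : Set GoldmanSpace} (ha : basisVec (word 1 0) ∈ S)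
    (hb : basisVec (word 0 1) ∈ S) (ha' : basisVec (word (-1) 0) ∈ S)
    (hb' : basisVec (word 0 (-1)) ∈ S) : nontrivialSpan ≤ isLieBracket_bracket.generate S :=
  nontrivialSpan_le (fun _ hx _ hy => isLieBracket_bracket.apply_mem_generate hx hy)
    (isLieBracket_bracket.subset_generate ha) (isLieBracket_bracket.subset_generate hb)
    (isLieBracket_bracket.subset_generate ha') (isLieBracket_bracket.subset_generate hb')

end Torus

theorem mainTheorem1 :
    ∃ B : Torus.GoldmanSpace →ₗ[ℚ] Torus.GoldmanSpace →ₗ[ℚ] Torus.GoldmanSpace,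
      Torus.IsGoldmanBracket B ∧
      (∀ B', Torus.IsGoldmanBracket B' → B' = B) ∧
      (∀ i j k l : ℤ,
        B (Torus.basisVec (Torus.word i j)) (Torus.basisVec (Torus.word k l)) =
          ((i * l - j * k : ℤ) : ℚ) • Torus.basisVec (Torus.word (i + k) (j + l))) ∧
      ∃ hB : IsLieBracket B,
        (∃ S : Set Torus.GoldmanSpace, S.Finite ∧ hB.generate S = ⊤) ∧
        hB.generate {Torus.basisVec (Torus.word 0 0),
          Torus.basisVec (Torus.word 1 0), Torus.basisVec (Torus.word 0 1),
          Torus.basisVec (Torus.word (-1) 0), Torus.basisVec (Torus.word 0 (-1))} = ⊤ ∧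
        hB.generate {Torus.basisVec (Torus.word 1 0), Torus.basisVec (Torus.word 0 1),
          Torus.basisVec (Torus.word (-1) 0), Torus.basisVec (Torus.word 0 (-1))} =
          Submodule.span ℚ (Torus.basisVec '' {c | c ≠ Torus.word 0 0}) := by
  have hB := Torus.isLieBracket_bracket
  have htop : hB.generate {Torus.basisVec (Torus.word 0 0),
      Torus.basisVec (Torus.word 1 0), Torus.basisVec (Torus.word 0 1),
      Torus.basisVec (Torus.word (-1) 0), Torus.basisVec (Torus.word 0 (-1))} = ⊤ := by
    rw [eq_top_iff, ← Torus.span_word, Submodule.span_le]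
    rintro _ ⟨⟨i, j⟩, rfl⟩
    by_cases h : (i, j) = (0, 0)
    · obtain ⟨rfl, rfl⟩ := Prod.ext_iff.1 h
      exact hB.subset_generate (Set.mem_insert _ _)
    · refine Torus.nontrivialSpan_le_generate ?_ ?_ ?_ ?_ (Torus.word_mem_nontrivialSpan h) <;> simp
  refine ⟨Torus.bracket, Torus.isGoldmanBracket_bracket,
    fun B' hB' => hB'.unique Torus.isGoldmanBracket_bracket, Torus.bracket_word, hB,
    ⟨_, Set.toFinite _, htop⟩, htop, le_antisymm ?_ ?_⟩
  · refine hB.generate_le ?_ fun x _ y _ => Torus.bracket_mem_nontrivialSpan x y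
    rintro _ (rfl | rfl | rfl | rfl) <;> exact Torus.word_mem_nontrivialSpan (by simp)
  · refine Torus.nontrivialSpan_le_generate ?_ ?_ ?_ ?_ <;> simp
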